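/- **Setting.** Let $B_n$ be the Artin braid group with generators $\sigma_1,\dots,\sigma_{n-1}$ (in a product $gh$ the braid $h$ comes first), $\rho:B_n\to S_n$ the standard homomorphism and $PB_n=\ker\rho$. In $B_3$ put $x_{12}=\sigma_1^2$, $x_{23}=\sigma_2^2$, $x_{13}=\sigma_2\sigma_1^2\sigma_2^{-1}$, and let $F_2=\langle x_{12},x_{23}\rangle\le PB_3$ (a free group). In $B_2$ put $y_{12}=\sigma_1^2$. Let $\mathsf{NFI}_{PB_4}(B_4)$ be the set of finite index normal subgroups $N$ of $B_4$ with $N\le PB_4$. For $N$ in it let $N_{PB_4}=N$; let $N_{PB_3}\le PB_3$ be the intersection of the preimages of $N$ under the five homomorphisms $\varphi_{123},\varphi_{234},\varphi_{12,3,4},\varphi_{1,23,4},\varphi_{1,2,34}:PB_3\to PB_4$, which add a vertical strand on the right, add one on the left, or double the first, second or third strand; and let $N_{PB_2}\le PB_2$ be the intersection of the preimages of $N_{PB_3}$ under the four analogous homomorphisms $\varphi_{12},\varphi_{23},\varphi_{12,3},\varphi_{1,23}:PB_2\to PB_3$. Put $N_{\mathrm{ord}}=[PB_2:N_{PB_2}]$.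 Let $\mathsf{PaB}^{\le 4}$ be the truncated operad (arities $1,\dots,4$) in groupoids of parenthesized braids: its objects in arity $n$ are the parenthesized permutations of $1,\dots,n$, its morphisms are the braids connecting equal labels, and insertion of $\eta$ at $i$ replaces the strand labelled $i$ by a thin copy of $\eta$. Let $\sim_N$ be the equivalence relation identifying two parallel morphisms of arity $n$ whose underlying braids $\gamma,\tilde\gamma$ satisfy $\gamma^{-1}\tilde\gamma\in N_{PB_n}$ (equality of morphisms if $n=1$). It is compatible with the operad structure, so that $\mathsf{PaB}^{\le4}/\!\sim_N$ is a truncated operad. Morphisms of truncated operads are always assumed to be the identity on objects. The groupoid $\mathsf{GTSh}$ has the object set $\mathsf{NFI}_{PB_4}(B_4)$, and its morphisms $\tilde N\to N$ are the isomorphisms of truncated operads $\mathsf{PaB}^{\le4}/\!\sim_{\tilde N}\ \to\ \mathsf{PaB}^{\le4}/\!\sim_N$, with the usual composition. Let $\alpha:(12)3\to1(23)$ be the associator (identity braid), $\beta:12\to21$ the braiding (braid $\sigma_1$), and for $g\in PB_n$ let $\mathfrak m(g)$ be the automorphism with underlying braid $g$ of the object $(\cdots(12)\cdots)n$. A *GT-pair*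 with target $N$ is an element $[(m,f)]=(m+N_{\mathrm{ord}}\mathbb Z,\ fN_{PB_3})$ of $\mathbb Z/N_{\mathrm{ord}}\times PB_3/N_{PB_3}$ such that $$\sigma_1x_{12}^m f^{-1}\sigma_2x_{23}^m f\,N_{PB_3}=f^{-1}\sigma_1\sigma_2(x_{13}x_{23})^m\,N_{PB_3},$$ $$f^{-1}\sigma_2x_{23}^m f\,\sigma_1x_{12}^m\,N_{PB_3}=\sigma_2\sigma_1(x_{12}x_{13})^m f\,N_{PB_3},$$ $$\varphi_{234}(f)\,\varphi_{1,23,4}(f)\,\varphi_{123}(f)\,N=\varphi_{1,2,34}(f)\,\varphi_{12,3,4}(f)\,N .$$ The morphism of truncated operads corresponding to it is the $T_{m,f}:\mathsf{PaB}^{\le4}\to\mathsf{PaB}^{\le4}/\!\sim_N$ with $T_{m,f}(\alpha)=[\alpha\cdot\mathfrak m(f)]$ and $T_{m,f}(\beta)=[\beta\cdot\mathfrak m(y_{12}^m)]$. For $n=2,3,4$ let $T^{PB_n}_{m,f}:PB_n\to PB_n/N_{PB_n}$ send $g$ to the coset of the braid underlying $T_{m,f}(\mathfrak m(g))$. A GT-pair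 is a *GT-shadow* if $T^{PB_2}_{m,f},T^{PB_3}_{m,f},T^{PB_4}_{m,f}$ are surjective; its target is $N$ and its source is $\ker T^{PB_4}_{m,f}$. A GT-shadow is *charming* if the coset $fN_{PB_3}$ contains an element of the commutator subgroup $[F_2,F_2]$ and the homomorphism $F_2\to F_2/(N_{PB_3}\cap F_2)$ obtained by restricting $T^{PB_3}_{m,f}$ (for $f$ so chosen) is surjective. Let $\mathsf{GT}^\heartsuit(N)$ be the set of charming GT-shadows with target $N$. An isomorphism $T:\mathsf{PaB}^{\le4}/\!\sim_{\tilde N}\ \to\ \mathsf{PaB}^{\le4}/\!\sim_N$ *corresponds* to the GT-pair $[(m,f)]$ if its composite with the projection $\mathsf{PaB}^{\le4}\to\mathsf{PaB}^{\le4}/\!\sim_{\tilde N}$ is $T_{m,f}$. **Proposition.** The assignment $$\mathrm{Hom}_{\mathsf{GTSh}^\heartsuit}(\tilde N,N)=\{[(m,f)]\in\mathsf{GT}^\heartsuit(N)\ :\ \tilde N=\ker T^{PB_4}_{m,f}\},\qquad \tilde N,N\in\mathsf{NFI}_{PB_4}(B_4),$$ upgrades $\mathsf{NFI}_{PB_4}(B_4)$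 to a groupoid, a subgroupoid of $\mathsf{GTSh}$. That is: every element of $\mathrm{Hom}_{\mathsf{GTSh}^\heartsuit}(\tilde N,N)$ corresponds to exactly one morphism $\tilde N\to N$ of $\mathsf{GTSh}$; every morphism of $\mathsf{GTSh}$ obtained in this way corresponds to exactly one element of $\mathrm{Hom}_{\mathsf{GTSh}^\heartsuit}(\tilde N,N)$; and the morphisms of $\mathsf{GTSh}$ obtained in this way contain the identities of all objects of $\mathsf{NFI}_{PB_4}(B_4)$ and are closed under composition and inverses. -/

import Mathlib

namespace GTShadow

open CategoryTheory

/-! ### Braid groups -/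

/-- Index set of the Artin generators of the braid group on `n` strands: the index `i` (with
`i + 1 < n`) stands for the generator crossing the strands in positions `i` and `i + 1`; positions
and generators are numbered from `0`. -/
abbrev Gen (n : ℕ) : Type := {i : ℕ // i + 1 < n}

/-- Artin's relations. -/
def braidRels (n : ℕ) : Set (FreeGroup (Gen n)) :=
  {r | (∃ i j : Gen n, i.1 + 2 ≤ j.1 ∧
        r = FreeGroup.of i * FreeGroup.of j * (FreeGroup.of i)⁻¹ * (FreeGroup.of j)⁻¹) ∨
      (∃ i j : Gen n, i.1 + 1 = j.1 ∧
        r = FreeGroup.of i * FreeGroup.of j * FreeGroup.of i *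
          (FreeGroup.of j)⁻¹ * (FreeGroup.of i)⁻¹ * (FreeGroup.of j)⁻¹)}

/-- The Artin braid group on `n` strands. In a product `g * h` the braid `h` comes first. -/
abbrev Braid (n : ℕ) : Type := PresentedGroup (braidRels n)

/-- The generator in which the strand in position `i` passes over the strand in position `i + 1`. -/
def σ {n : ℕ} (i : ℕ) (hi : i + 1 < n) : Braid n := PresentedGroup.of ⟨i, hi⟩

theorem σ_comm {n i j : ℕ} (hi : i + 1 < n) (hj : j + 1 < n) (h : i + 2 ≤ j) :
    σ i hi * σ j hj = σ j hj * σ i hi := by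
  have := PresentedGroup.one_of_mem (rels := braidRels n)
    (Or.inl ⟨⟨i, hi⟩, ⟨j, hj⟩, h, rfl⟩)
  simp only [map_mul, map_inv] at this
  change σ i hi * σ j hj * (σ i hi)⁻¹ * (σ j hj)⁻¹ = 1 at this
  rw [mul_inv_eq_one, mul_inv_eq_iff_eq_mul] at this
  exact this

theorem σ_braid {n i : ℕ} (hi : i + 1 < n) (hj : i + 1 + 1 < n) :
    σ i hi * σ (i + 1) hj * σ i hi = σ (i + 1) hj * σ i hi * σ (i + 1) hj := by
  have := PresentedGroup.one_of_mem (rels := braidRels n)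
    (Or.inr ⟨⟨i, hi⟩, ⟨i + 1, hj⟩, rfl, rfl⟩)
  simp only [map_mul, map_inv] at this
  change σ i hi * σ (i + 1) hj * σ i hi * (σ (i + 1) hj)⁻¹ * (σ i hi)⁻¹ *
    (σ (i + 1) hj)⁻¹ = 1 at this
  rw [mul_inv_eq_one, mul_inv_eq_iff_eq_mul, mul_inv_eq_iff_eq_mul] at this
  exact this

/-- Homomorphisms out of a braid group. -/
def Braid.lift {n : ℕ} {G : Type*} [Group G] (f : ∀ i : ℕ, i + 1 < n → G)
    (hc : ∀ i j (hi : i + 1 < n) (hj : j + 1 < n), i + 2 ≤ j → f i hi * f j hj = f j hj * f i hi)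
    (hb : ∀ i (hi : i + 1 < n) (hj : i + 1 + 1 < n),
      f i hi * f (i + 1) hj * f i hi = f (i + 1) hj * f i hi * f (i + 1) hj) :
    Braid n →* G :=
  PresentedGroup.toGroup (f := fun i : Gen n => f i.1 i.2) (by
    rintro r (⟨⟨i, hi⟩, ⟨j, hj⟩, h, rfl⟩ | ⟨⟨i, hi⟩, ⟨j, hj⟩, h, rfl⟩)
    · simp only [map_mul, map_inv, FreeGroup.lift_apply_of]
      rw [mul_inv_eq_one, mul_inv_eq_iff_eq_mul]
      exact hc i j hi hj h
    · dsimp only at h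
      subst h
      simp only [map_mul, map_inv, FreeGroup.lift_apply_of]
      rw [mul_inv_eq_one, mul_inv_eq_iff_eq_mul, mul_inv_eq_iff_eq_mul]
      exact hb i hi hj)

@[simp] theorem Braid.lift_σ {n : ℕ} {G : Type*} [Group G] (f : ∀ i : ℕ, i + 1 < n → G) (hc) (hb)
    (i : ℕ) (hi : i + 1 < n) : Braid.lift f hc hb (σ i hi) = f i hi :=
  PresentedGroup.toGroup.of _

theorem Braid.hom_ext {n : ℕ} {G : Type*} [Group G] {f g : Braid n →* G}
    (h : ∀ i (hi : i + 1 < n), f (σ i hi) = g (σ i hi)) : f = g :=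
  PresentedGroup.ext fun i => h i.1 i.2

theorem Braid.induction {n : ℕ} {P : Braid n → Prop} (one : P 1)
    (gen : ∀ i (hi : i + 1 < n), P (σ i hi)) (mul : ∀ g h, P g → P h → P (g * h))
    (inv : ∀ g, P g → P g⁻¹) (g : Braid n) : P g :=
  PresentedGroup.generated_by (braidRels n)
    { carrier := {g | P g}, one_mem' := one, mul_mem' := fun {a b} => mul a b,
      inv_mem' := fun {a} => inv a }
    (fun i => gen i.1 i.2) g

/-- The transposition of the positions `i` and `i + 1`. -/
def adj {n : ℕ} (i : ℕ) (hi : i + 1 < n) : Equiv.Perm (Fin n) :=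
  Equiv.swap ⟨i, by omega⟩ ⟨i + 1, hi⟩

theorem adj_val {n : ℕ} (i : ℕ) (hi : i + 1 < n) (x : Fin n) :
    (adj i hi x).1 = if x.1 = i then i + 1 else if x.1 = i + 1 then i else x.1 := by
  unfold adj
  rw [Equiv.swap_apply_def]
  simp only [Fin.ext_iff]
  split_ifs <;> rfl

theorem adj_adj {n : ℕ} (i : ℕ) (hi : i + 1 < n) (x : Fin n) : adj i hi (adj i hi x) = x :=
  Equiv.swap_apply_self _ _ _

theorem adj_inv {n : ℕ} (i : ℕ) (hi : i + 1 < n) : (adj i hi)⁻¹ = adj i hi :=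
  Equiv.swap_inv _ _

/-- The permutation of a braid: the strand that starts in position `p` ends in position
`ρ g p`. -/
def ρ {n : ℕ} : Braid n →* Equiv.Perm (Fin n) :=
  Braid.lift adj
    (by
      intro i j hi hj h; ext x
      simp only [Equiv.Perm.mul_apply, adj_val]
      grind)
    (by
      intro i hi hj; ext x
      simp only [Equiv.Perm.mul_apply, adj_val]
      grind)

@[simp] theorem ρ_σ {n : ℕ} (i : ℕ) (hi : i + 1 < n) : ρ (σ i hi) = adj i hi :=
  Braid.lift_σ ..

/-- The pure braid group, as a subgroup of the braid group. -/
def PB (n : ℕ) : Subgroup (Braid n) := (ρ : Braid n →* _).ker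

/-! ### Doubling a strand -/

/-- The effect on a generator of replacing the strand that starts in position `p` by two parallel
strands. -/
def dblGen {n : ℕ} (i : ℕ) (hi : i + 1 < n) (p : ℕ) : Braid (n + 1) :=
  if p < i then σ (i + 1) (by omega)
  else if p = i then σ i (by omega) * σ (i + 1) (by omega)
  else if p = i + 1 then σ (i + 1) (by omega) * σ i (by omega)
  else σ i (by omega)

theorem dblGen_comm {n i j : ℕ} (hi : i + 1 < n) (hj : j + 1 < n) (h : i + 2 ≤ j) (p : Fin n) :
    dblGen i hi (adj j hj p) * dblGen j hj p = dblGen j hj (adj i hi p) * dblGen i hi p := by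
  have c00 := σ_comm (n := n + 1) (i := i) (j := j) (by omega) (by omega) h
  have c01 := σ_comm (n := n + 1) (i := i) (j := j + 1) (by omega) (by omega) (by omega)
  have c11 := σ_comm (n := n + 1) (i := i + 1) (j := j + 1) (by omega) (by omega) (by omega)
  rw [adj_val, adj_val]
  obtain ⟨p, hp⟩ := p
  dsimp only
  rcases lt_trichotomy p i with h1 | rfl | h1
  · simp [dblGen, show p ≠ i by omega, show p ≠ i + 1 by omega, show p ≠ j by omega,
      show p ≠ j + 1 by omega, show p < i by omega, show p < j by omega, c11]
  · simp [dblGen, show p ≠ j by omega, show p ≠ j + 1 by omega, show p < j by omega,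
      show p + 1 < j by omega]
    rw [mul_assoc, c11, ← mul_assoc, c01, mul_assoc]
  rcases eq_or_ne p (i + 1) with rfl | h2
  · simp [dblGen, show i + 1 ≠ j by omega, show i ≠ j by omega, show i < j by omega,
      show i + 1 < j by omega]
    rw [mul_assoc, c01, ← mul_assoc, c11, mul_assoc]
  rcases lt_trichotomy p j with h3 | rfl | h3
  · simp [dblGen, show p ≠ i by omega, show p ≠ i + 1 by omega, show p ≠ j by omega,
      show p ≠ j + 1 by omega, show ¬ p < i by omega, show p < j by omega, c01]
  · simp [dblGen, show p ≠ i by omega, show p ≠ i + 1 by omega, show p + 1 ≠ i by omega,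
      show ¬ p < i by omega, show ¬ p + 1 < i by omega]
    rw [← mul_assoc, c00, mul_assoc, c01, mul_assoc]
  rcases eq_or_ne p (j + 1) with rfl | h4
  · simp [dblGen, show j + 1 ≠ i by omega, show j ≠ i by omega, show ¬ j < i by omega,
      show ¬ j + 1 < i by omega, show j ≠ i + 1 by omega]
    rw [← mul_assoc, c01, mul_assoc, c00, mul_assoc]
  · simp [dblGen, show p ≠ i by omega, show p ≠ i + 1 by omega, show p ≠ j by omega,
      show p ≠ j + 1 by omega, show ¬ p < i by omega, show ¬ p < j by omega, c00]

theorem word_aux {G : Type*} [Group G] {a b c : G} (h : a * c = c * a)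
    (h0 : a * b * a = b * a * b) (h1 : b * c * b = c * b * c) :
    a * (b * c) * (a * b) = b * c * (a * b) * c ∧ a * b * c * (b * a) = c * b * a * (b * c) ∧
      b * a * (c * b) * a = c * (b * a) * (c * b) := by
  refine ⟨?_, ?_, ?_⟩
  · calc a * (b * c) * (a * b) = a * b * (c * a) * b := by group
      _ = (a * b * a) * c * b := by rw [← h]; group
      _ = b * a * (b * c * b) := by rw [h0]; group
      _ = b * (a * c) * b * c := by rw [h1]; group
      _ = _ := by rw [h]; group
  · calc a * b * c * (b * a) = a * (b * c * b) * a := by group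
      _ = (a * c) * b * (c * a) := by rw [h1]; group
      _ = (c * a) * b * (a * c) := by rw [h]
      _ = c * (a * b * a) * c := by group
      _ = _ := by rw [h0]; group
  · calc b * a * (c * b) * a = b * (a * c) * b * a := by group
      _ = b * c * (a * b * a) := by rw [h]; group
      _ = (b * c * b) * a * b := by rw [h0]; group
      _ = c * b * (c * a) * b := by rw [h1]; group
      _ = _ := by rw [← h]; group

theorem dblGen_braid {n i : ℕ} (hi : i + 1 < n) (hj : i + 1 + 1 < n) (p : Fin n) :
    dblGen i hi (adj (i + 1) hj (adj i hi p)) * dblGen (i + 1) hj (adj i hi p) * dblGen i hi p =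
      dblGen (i + 1) hj (adj i hi (adj (i + 1) hj p)) * dblGen i hi (adj (i + 1) hj p) *
        dblGen (i + 1) hj p := by
  have c := σ_comm (n := n + 1) (i := i) (j := i + 2) (by omega) (by omega) le_rfl
  have b0 := σ_braid (n := n + 1) (i := i) (by omega) (by omega)
  have b1 := σ_braid (n := n + 1) (i := i + 1) (by omega) (by omega)
  simp only [adj_val]
  obtain ⟨p, hp⟩ := p
  dsimp only
  rcases lt_or_ge p i with h1 | h1
  · simp [dblGen, show p ≠ i by omega, show p ≠ i + 1 by omega, show p ≠ i + 1 + 1 by omega,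
      h1, show p < i + 1 by omega, b1]
  obtain rfl | rfl | rfl | h2 : p = i ∨ p = i + 1 ∨ p = i + 2 ∨ i + 2 < p := by omega
  · simp [dblGen, show p ≠ p + 1 + 1 by omega, show p + 1 + 1 ≠ p by omega,
      show ¬ p + 1 + 1 < p by omega]
    exact (word_aux c b0 b1).1
  · simp [dblGen, show i ≠ i + 1 + 1 by omega, show i + 1 + 1 ≠ i by omega,
      show ¬ i + 1 + 1 < i by omega, show ¬ i + 1 + 1 ≤ i by omega]
    exact (word_aux c b0 b1).2.1
  · simp [dblGen]
    exact (word_aux c b0 b1).2.2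
  · simp [dblGen, show p ≠ i by omega, show p ≠ i + 1 by omega, show p ≠ i + 1 + 1 by omega,
      show ¬ p < i by omega, show ¬ p < i + 1 by omega, b0]

/-- The group of pairs of a permutation `perm` of the `n` positions and a family `val` of elements
of `G` indexed by the positions; the `p`-th entry of a product `a * b` is
`a.val (b.perm p) * b.val p`. This is the wreath product of `G` and the symmetric group. -/
@[ext] structure Twisted (n : ℕ) (G : Type) where
  perm : Equiv.Perm (Fin n)
  val : Fin n → G

instance {n : ℕ} {G : Type} [Group G] : Group (Twisted n G) where
  mul a b := ⟨a.perm * b.perm, fun p => a.val (b.perm p) * b.val p⟩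
  one := ⟨1, fun _ => 1⟩
  inv a := ⟨a.perm⁻¹, fun p => (a.val (a.perm⁻¹ p))⁻¹⟩
  mul_assoc a b c := Twisted.ext rfl (funext fun _ => mul_assoc _ _ _)
  one_mul a := Twisted.ext rfl (funext fun _ => one_mul _)
  mul_one a := Twisted.ext rfl (funext fun _ => mul_one _)
  inv_mul_cancel a := Twisted.ext (inv_mul_cancel a.perm) (funext fun p => by
    change (a.val (a.perm⁻¹ (a.perm p)))⁻¹ * a.val p = 1
    simp)

/-- The homomorphism that doubles the strand starting in position `p`, for all `p` at once. -/
def dblHom (n : ℕ) : Braid n →* Twisted n (Braid (n + 1)) :=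
  Braid.lift (fun i hi => ⟨adj i hi, fun p => dblGen i hi p⟩)
    (fun i j hi hj h => Twisted.ext
      (by change adj i hi * adj j hj = adj j hj * adj i hi
          simp only [← ρ_σ, ← map_mul, σ_comm hi hj h])
      (funext fun p => dblGen_comm hi hj h p))
    (fun i hi hj => Twisted.ext
      (by change adj i hi * adj (i + 1) hj * adj i hi = adj (i + 1) hj * adj i hi * adj (i + 1) hj
          simp only [← ρ_σ, ← map_mul, σ_braid hi hj])
      (funext fun p => dblGen_braid hi hj p))

theorem dblHom_perm {n : ℕ} (g : Braid n) : (dblHom n g).perm = ρ g := by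
  let F : Twisted n (Braid (n + 1)) →* Equiv.Perm (Fin n) :=
    { toFun := Twisted.perm, map_one' := rfl, map_mul' := fun _ _ => rfl }
  have : F.comp (dblHom n) = ρ := Braid.hom_ext fun i hi => by simp [dblHom, F]
  exact DFunLike.congr_fun this g

/-- `dbl p g` is the braid obtained from `g` by replacing the strand that starts in position `p`
by two parallel strands. -/
def dbl {n : ℕ} (p : Fin n) (g : Braid n) : Braid (n + 1) := (dblHom n g).val p

theorem dbl_mul {n : ℕ} (p : Fin n) (g h : Braid n) :
    dbl p (g * h) = dbl (ρ h p) g * dbl p h := by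
  rw [← dblHom_perm, dbl, map_mul]
  rfl

theorem dbl_one {n : ℕ} (p : Fin n) : dbl p (1 : Braid n) = 1 := by
  rw [dbl, map_one]
  rfl

theorem dbl_inv {n : ℕ} (p : Fin n) (g : Braid n) : dbl p g⁻¹ = (dbl (ρ g⁻¹ p) g)⁻¹ := by
  rw [eq_inv_iff_mul_eq_one]
  have := dbl_mul (ρ g⁻¹ p) g⁻¹ g
  rw [inv_mul_cancel, dbl_one, map_inv, show ρ g ((ρ g)⁻¹ p) = p from (ρ g).apply_symm_apply p] at this
  rw [map_inv, this]

theorem dbl_σ {n : ℕ} (i : ℕ) (hi : i + 1 < n) (p : Fin n) : dbl p (σ i hi) = dblGen i hi p := by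
  rw [dbl, dblHom, Braid.lift_σ]

/-! ### Insertion of permutations and of braids -/

/-- A set of `n` positions in which the position `p` is blown up to a block of `k + 1` consecutive
positions: the positions other than `p`, and the positions in the block, as positions among
`n + k`. -/
def place {n : ℕ} (k : ℕ) (p : Fin n) : {q : Fin n // q ≠ p} ⊕ Fin (k + 1) ≃ Fin (n + k) where
  toFun
    | .inl q => if q.1.1 < p.1 then ⟨q.1.1, by omega⟩ else ⟨q.1.1 + k, by omega⟩
    | .inr j => ⟨p.1 + j.1, by omega⟩
  invFun x :=
    if h : x.1 < p.1 then .inl ⟨⟨x.1, by omega⟩, fun e => by simp [← e] at h⟩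
    else if h' : x.1 ≤ p.1 + k then .inr ⟨x.1 - p.1, by omega⟩
    else .inl ⟨⟨x.1 - k, by omega⟩, fun e => by
      have := congrArg Fin.val e
      simp only at this
      omega⟩
  left_inv := by
    rintro (⟨⟨q, hq⟩, hqp⟩ | ⟨j, hj⟩)
    · have : q ≠ p.1 := fun e => hqp (Fin.ext e)
      dsimp only
      by_cases h : q < p.1
      · simp [h]
      · simp [h, show ¬ q + k < p.1 by omega, show ¬ q + k ≤ p.1 + k by omega]
    · simp [show j ≤ k by omega]
  right_inv := by
    rintro ⟨x, hx⟩
    dsimp only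
    by_cases h : x < p.1
    · simp [h]
    by_cases h' : x ≤ p.1 + k
    · simp [h, h', show p.1 + (x - p.1) = x by omega]
    · simp [h, h', show ¬ x - k < p.1 by omega, show x - k + k = x by omega]

theorem place_inl_val {n : ℕ} (k : ℕ) (p q : Fin n) (hq : q ≠ p) :
    (place k p (.inl ⟨q, hq⟩)).1 = if q.1 < p.1 then q.1 else q.1 + k := by
  simp only [place, Equiv.coe_fn_mk]
  split_ifs <;> rfl

theorem place_inr_val {n : ℕ} (k : ℕ) (p : Fin n) (j : Fin (k + 1)) :
    (place k p (.inr j)).1 = p.1 + j.1 := rfl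

/-- Insertion of the permutation `t` of a block of `k + 1` positions into the permutation `s` of
`n` positions: the block located at `p` is moved as a whole to the block located at `s p` and is
permuted internally by `t`. -/
def blockPerm {n : ℕ} (k : ℕ) (s : Equiv.Perm (Fin n)) (p : Fin n)
    (t : Equiv.Perm (Fin (k + 1))) : Equiv.Perm (Fin (n + k)) :=
  (place k p).symm.trans
    ((Equiv.sumCongr (s.subtypeEquiv fun q => by simp) t).trans (place k (s p)))

theorem blockPerm_place_inl {n : ℕ} (k : ℕ) (s : Equiv.Perm (Fin n)) (p : Fin n)
    (t : Equiv.Perm (Fin (k + 1))) (q : Fin n) (hq : q ≠ p) :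
    blockPerm k s p t (place k p (.inl ⟨q, hq⟩)) =
      place k (s p) (.inl ⟨s q, fun e => hq (s.injective e)⟩) := by
  simp [blockPerm]

theorem blockPerm_place_inr {n : ℕ} (k : ℕ) (s : Equiv.Perm (Fin n)) (p : Fin n)
    (t : Equiv.Perm (Fin (k + 1))) (j : Fin (k + 1)) :
    blockPerm k s p t (place k p (.inr j)) = place k (s p) (.inr (t j)) := by
  simp [blockPerm]

theorem perm_ext_place {n k : ℕ} (p : Fin n) {a b : Equiv.Perm (Fin (n + k))}
    (hl : ∀ q hq, a (place k p (.inl ⟨q, hq⟩)) = b (place k p (.inl ⟨q, hq⟩)))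
    (hr : ∀ j, a (place k p (.inr j)) = b (place k p (.inr j))) : a = b := by
  ext x : 1
  obtain ⟨y | j, rfl⟩ := (place k p).surjective x
  · exact hl _ _
  · exact hr _

theorem blockPerm_mul {n : ℕ} (k : ℕ) (s s' : Equiv.Perm (Fin n)) (p : Fin n)
    (t t' : Equiv.Perm (Fin (k + 1))) :
    blockPerm k (s * s') p (t * t') = blockPerm k s (s' p) t * blockPerm k s' p t' := by
  refine perm_ext_place p (fun q hq => ?_) (fun j => ?_)
  · simp only [Equiv.Perm.mul_apply, blockPerm_place_inl]; rfl
  · simp only [Equiv.Perm.mul_apply, blockPerm_place_inr]; rfl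

theorem blockPerm_one {n : ℕ} (k : ℕ) (p : Fin n) : blockPerm k 1 p 1 = 1 := by
  refine perm_ext_place p (fun q hq => ?_) (fun j => ?_)
  · rw [blockPerm_place_inl]; rfl
  · rw [blockPerm_place_inr]; rfl

theorem ρ_dblGen {n : ℕ} (i : ℕ) (hi : i + 1 < n) (p : Fin n) :
    ρ (dblGen i hi p) = blockPerm 1 (adj i hi) p 1 := by
  refine perm_ext_place p (fun q hq => ?_) (fun j => ?_)
  · rw [blockPerm_place_inl]
    have hq' : q.1 ≠ p.1 := fun e => hq (Fin.ext e)
    apply Fin.ext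
    simp only [place, Equiv.coe_fn_mk, adj_val, dblGen]
    split_ifs <;> simp [Equiv.Perm.mul_apply, adj_val] <;> grind
  · rw [blockPerm_place_inr]
    apply Fin.ext
    simp only [place, Equiv.coe_fn_mk, adj_val, dblGen, Equiv.Perm.one_apply]
    split_ifs <;> simp [Equiv.Perm.mul_apply, adj_val] <;> grind

theorem ρ_dbl {n : ℕ} (p : Fin n) (g : Braid n) : ρ (dbl p g) = blockPerm 1 (ρ g) p 1 := by
  induction g using Braid.induction generalizing p with
  | one => rw [dbl_one, map_one, map_one, blockPerm_one]
  | gen i hi => rw [dbl_σ, ρ_dblGen, ρ_σ]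
  | mul g h hg hh => rw [dbl_mul, map_mul, hg, hh, map_mul, ← blockPerm_mul, one_mul]
  | inv g hg =>
    rw [dbl_inv, map_inv, hg, inv_eq_iff_mul_eq_one, map_inv]
    have := blockPerm_mul 1 (ρ g) (ρ g)⁻¹ p 1 1
    rw [mul_inv_cancel, one_mul, blockPerm_one] at this
    exact this.symm

/-- `cab k p g` is the braid obtained from `g` by replacing the strand that starts in position `p`
by `k + 1` parallel strands. -/
def cab {n : ℕ} : ∀ (k : ℕ), Fin n → Braid n → Braid (n + k)
  | 0, _, g => g
  | k + 1, p, g => dbl (Fin.castAdd k p) (cab k p g)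

theorem ρ_cab {n : ℕ} (k : ℕ) (p : Fin n) (g : Braid n) :
    ρ (cab k p g) = blockPerm k (ρ g) p 1 := by
  induction k with
  | zero =>
    refine perm_ext_place p (fun q hq => ?_) (fun j => ?_)
    · rw [blockPerm_place_inl]; simp [cab, place]
    · rw [blockPerm_place_inr]
      obtain rfl : j = 0 := Subsingleton.elim (α := Fin 1) _ _
      simp [cab, place]
  | succ k ih =>
    rw [cab, ρ_dbl, ih]
    have hp : ∀ x : Fin n, Fin.castAdd k x = place k x (.inr 0) := fun x => by
      apply Fin.ext; simp [place]
    have hne : ∀ (x q : Fin n) (hq : q ≠ x), place k x (.inl ⟨q, hq⟩) ≠ Fin.castAdd k x := by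
      intro x q hq e
      rw [hp] at e
      simpa using (place k x).injective e
    have hne' : ∀ (x : Fin n) (j : Fin k), place k x (.inr j.succ) ≠ Fin.castAdd k x := by
      intro x j e
      rw [hp] at e
      simpa using (place k x).injective e
    have hl : ∀ (x q : Fin n) (hq : q ≠ x), place (k + 1) x (.inl ⟨q, hq⟩) =
        place 1 (Fin.castAdd k x) (.inl ⟨place k x (.inl ⟨q, hq⟩), hne x q hq⟩) := by
      intro x q hq
      have hq' : q.1 ≠ x.1 := fun e => hq (Fin.ext e)
      apply Fin.ext
      simp only [place, Equiv.coe_fn_mk, Fin.val_castAdd]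
      split_ifs <;> grind
    have hs : ∀ (x : Fin n) (j : Fin k), place (k + 1) x (.inr j.succ.succ) =
        place 1 (Fin.castAdd k x) (.inl ⟨place k x (.inr j.succ), hne' x j⟩) := by
      intro x j
      apply Fin.ext
      simp only [place, Equiv.coe_fn_mk, Fin.val_castAdd]
      split_ifs <;> grind
    have h01 : ∀ (x : Fin n) (j : Fin 2), place (k + 1) x (.inr ⟨j.1, by omega⟩) =
        place 1 (Fin.castAdd k x) (.inr j) := by
      intro x j
      apply Fin.ext
      simp [place]
    have hb : blockPerm k (ρ g) p 1 (Fin.castAdd k p) = Fin.castAdd k (ρ g p) := by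
      rw [hp, hp, blockPerm_place_inr]; rfl
    have key : ∀ {x x' y y' : Fin (n + k)} (hy : y ≠ x) (hy' : y' ≠ x'), x = x' → y = y' →
        place 1 x (.inl ⟨y, hy⟩) = place 1 x' (.inl ⟨y', hy'⟩) := by
      rintro x _ y _ hy hy' rfl rfl; rfl
    refine perm_ext_place (k := k + 1) p (fun q hq => ?_) (fun j => ?_)
    · refine (congrArg _ (hl p q hq)).trans ?_
      rw [blockPerm_place_inl]
      refine Eq.trans ?_ (blockPerm_place_inl (k + 1) (ρ g) p 1 q hq).symm
      refine Eq.trans ?_ (hl _ _ _).symm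
      exact key _ _ hb (blockPerm_place_inl ..)
    · refine Eq.trans ?_ (blockPerm_place_inr (k + 1) (ρ g) p 1 j).symm
      obtain ⟨j, hj⟩ := j
      match j, hj with
      | 0, _ =>
        refine (congrArg _ (h01 p 0)).trans (Eq.trans ?_ (h01 (ρ g p) 0).symm)
        rw [blockPerm_place_inr, hb]
        rfl
      | 1, _ =>
        refine (congrArg _ (h01 p 1)).trans (Eq.trans ?_ (h01 (ρ g p) 1).symm)
        rw [blockPerm_place_inr, hb]
        rfl
      | j + 2, hj =>
        have e := hs p ⟨j, by omega⟩
        have e' := hs (ρ g p) ⟨j, by omega⟩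
        refine (congrArg _ e).trans (Eq.trans ?_ e'.symm)
        rw [blockPerm_place_inl]
        exact key _ _ hb (by rw [blockPerm_place_inr]; rfl)

theorem cab_mul {n : ℕ} (k : ℕ) (p : Fin n) (g h : Braid n) :
    cab k p (g * h) = cab k (ρ h p) g * cab k p h := by
  induction k with
  | zero => rfl
  | succ k ih =>
    have hp : ∀ x : Fin n, Fin.castAdd k x = place k x (.inr 0) := fun x => by
      apply Fin.ext; simp [place]
    rw [cab, cab, cab, ih, dbl_mul, ρ_cab, hp, blockPerm_place_inr, ← hp]
    rfl

theorem cab_one {n : ℕ} (k : ℕ) (p : Fin n) : cab k p (1 : Braid n) = 1 := by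
  induction k with
  | zero => rfl
  | succ k ih => rw [cab, ih, dbl_one]

/-- Adding vertical strands: the inclusion of the braid group on `m` strands into the one on `N`
strands as the braids of the strands in the positions `p, …, p + m - 1`. -/
def embed {m N : ℕ} (p : ℕ) (h : p + m ≤ N) : Braid m →* Braid N :=
  Braid.lift (fun i hi => σ (p + i) (by omega))
    (fun i j hi hj hij => σ_comm _ _ (by omega))
    (fun i hi hj => σ_braid _ _)

@[simp] theorem embed_σ {m N : ℕ} (p : ℕ) (h : p + m ≤ N) (i : ℕ) (hi : i + 1 < m) :
    embed p h (σ i hi) = σ (p + i) (by omega) :=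
  Braid.lift_σ ..

theorem ρ_embed {n : ℕ} (k : ℕ) (p : Fin n) (h : Braid (k + 1)) :
    ρ (embed (N := n + k) p.1 (by omega) h) = blockPerm k 1 p (ρ h) := by
  let F : Equiv.Perm (Fin (k + 1)) →* Equiv.Perm (Fin (n + k)) :=
    { toFun := fun t => blockPerm k 1 p t
      map_one' := blockPerm_one k p
      map_mul' := fun t t' => by
        have := blockPerm_mul k 1 1 p t t'
        rwa [one_mul] at this }
  have : ρ.comp (embed (m := k + 1) (N := n + k) p.1 (by omega)) = F.comp ρ := by
    refine Braid.hom_ext fun i hi => ?_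
    simp only [MonoidHom.comp_apply, embed_σ, ρ_σ]
    change _ = blockPerm k 1 p (adj i hi)
    refine perm_ext_place p (fun q hq => ?_) (fun j => ?_)
    · rw [blockPerm_place_inl]
      have hq' : q.1 ≠ p.1 := fun e => hq (Fin.ext e)
      apply Fin.ext
      rw [adj_val, place_inl_val, place_inl_val]
      simp only [Equiv.Perm.one_apply]
      by_cases hlt : q.1 < p.1 <;> simp only [hlt, if_true, if_false] <;> split_ifs <;> omega
    · rw [blockPerm_place_inr]
      apply Fin.ext
      rw [adj_val, place_inr_val, place_inr_val, adj_val]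
      simp only [Equiv.Perm.one_apply]
      split_ifs <;> omega
  exact DFunLike.congr_fun this h

/-- The braid obtained from `g` by replacing the strand that starts in position `p` by a thin
version of the braid `h` on `k + 1` strands. -/
def insBraid {n : ℕ} (k : ℕ) (g : Braid n) (p : Fin n) (h : Braid (k + 1)) : Braid (n + k) :=
  cab k p g * embed p.1 (by omega) h

theorem ρ_insBraid {n : ℕ} (k : ℕ) (g : Braid n) (p : Fin n) (h : Braid (k + 1)) :
    ρ (insBraid k g p h) = blockPerm k (ρ g) p (ρ h) := by
  rw [insBraid, map_mul, ρ_cab, ρ_embed]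
  have := blockPerm_mul k (ρ g) 1 p 1 (ρ h)
  rw [mul_one, one_mul] at this
  exact this.symm

/-! ### The groupoids of parenthesized braids -/

/-- Replace the leaf in position `p` of a parenthesization (a word of the free magma on one
generator) by another parenthesization. -/
def graft : FreeMagma Unit → ℕ → FreeMagma Unit → FreeMagma Unit
  | .of _, _, v => v
  | .mul a b, p, v => if p < a.length then .mul (graft a p v) b else .mul a (graft b (p - a.length) v)

theorem length_graft (w : FreeMagma Unit) (p : ℕ) (v : FreeMagma Unit) :
    (graft w p v).length + 1 = w.length + v.length := by
  induction w generalizing p with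
  | ih1 _ => simp [graft, FreeMagma.length, add_comm]
  | ih2 a b iha ihb =>
    change (graft (.mul a b) p v).length + 1 = a.length + b.length + v.length
    rw [graft]
    split_ifs
    · change (graft a p v).length + b.length + 1 = _
      have := iha p
      omega
    · change a.length + (graft b (p - a.length) v).length + 1 = _
      have := ihb (p - a.length)
      omega

/-- Objects of the groupoid of parenthesized braids on `n` strands: a parenthesization of the
sequence `lab 0, …, lab (n - 1)`, where `lab` is a permutation of the labels. -/
@[ext] structure Obj (n : ℕ) where
  /-- the parenthesization -/
  tree : FreeMagma Unit
  length_tree : tree.length = n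
  /-- the label in each position -/
  lab : Equiv.Perm (Fin n)

/-- The left action of the symmetric group, by relabelling. -/
def Obj.act {n : ℕ} (θ : Equiv.Perm (Fin n)) (a : Obj n) : Obj n := ⟨a.tree, a.length_tree, θ * a.lab⟩

/-- The position of a label. -/
def Obj.pos {n : ℕ} (a : Obj n) (i : Fin n) : Fin n := a.lab.symm i

/-- Operadic insertion `a ∘ᵢ c`: the word `c`, with labels shifted by `i`, is substituted for the
label `i` of `a`, the labels of `a` greater than `i` being shifted by `k`. -/
def Obj.ins {n k : ℕ} (a : Obj n) (i : Fin n) (c : Obj (k + 1)) : Obj (n + k) where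
  tree := graft a.tree (a.pos i) c.tree
  length_tree := by
    have := length_graft a.tree (a.pos i) c.tree
    rw [a.length_tree, c.length_tree] at this
    omega
  lab := blockPerm k a.lab (a.pos i) c.lab

/-- Morphisms of parenthesized braids from `a` to `b`: the braids that connect equal labels. -/
@[ext] structure Mor {n : ℕ} (a b : Obj n) where
  /-- the underlying braid -/
  braid : Braid n
  lab_eq : b.lab * ρ braid = a.lab

namespace Mor

theorem pos_eq {n : ℕ} {a b : Obj n} (γ : Mor a b) (i : Fin n) : ρ γ.braid (a.pos i) = b.pos i := by
  unfold Obj.pos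
  rw [Equiv.eq_symm_apply, ← Equiv.Perm.mul_apply, γ.lab_eq, Equiv.apply_symm_apply]

/-- The identity. -/
def id {n : ℕ} (a : Obj n) : Mor a a := ⟨1, by rw [map_one, mul_one]⟩

/-- Composition `γ · η`, with `η` first. -/
def comp {n : ℕ} {a b c : Obj n} (γ : Mor b c) (η : Mor a b) : Mor a c :=
  ⟨γ.braid * η.braid, by rw [map_mul, ← mul_assoc, γ.lab_eq, η.lab_eq]⟩

/-- Action of the symmetric group. -/
def act {n : ℕ} {a b : Obj n} (θ : Equiv.Perm (Fin n)) (γ : Mor a b) : Mor (a.act θ) (b.act θ) :=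
  ⟨γ.braid, by change θ * b.lab * _ = θ * a.lab; rw [mul_assoc, γ.lab_eq]⟩

/-- Operadic insertion `γ ∘ᵢ η`: the strand of `γ` labelled by `i` is replaced by a thin version
of `η`. -/
def ins {n k : ℕ} {a b : Obj n} {c d : Obj (k + 1)} (γ : Mor a b) (i : Fin n) (η : Mor c d) :
    Mor (a.ins i c) (b.ins i d) :=
  ⟨insBraid k γ.braid (a.pos i) η.braid, by
    rw [ρ_insBraid]
    change blockPerm k b.lab (b.pos i) d.lab * _ = blockPerm k a.lab (a.pos i) c.lab
    rw [← γ.pos_eq i, ← blockPerm_mul, γ.lab_eq, η.lab_eq]⟩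

end Mor

/-! ### The compatible equivalence relations -/

theorem mem_PB {n : ℕ} {g : Braid n} : g ∈ PB n ↔ ρ g = 1 := MonoidHom.mem_ker

/-- For a subgroup `N` of the braid group on `n + 1` strands, the intersection of the preimages of
`N` in the pure braid group on `n` strands under the coface maps: adding a vertical strand on the
right or on the left, and doubling any one of the `n` strands. -/
def face {n : ℕ} (N : Subgroup (Braid (n + 1))) : Subgroup (Braid n) where
  carrier := {h | h ∈ PB n ∧ embed 0 (by omega) h ∈ N ∧ embed 1 (by omega) h ∈ N ∧
    ∀ p : Fin n, dbl p h ∈ N}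
  one_mem' := ⟨one_mem _, by rw [map_one]; exact one_mem _, by rw [map_one]; exact one_mem _,
    fun p => by rw [dbl_one]; exact one_mem _⟩
  mul_mem' := by
    rintro a b ⟨ha, ha0, ha1, had⟩ ⟨hb, hb0, hb1, hbd⟩
    refine ⟨mul_mem ha hb, by rw [map_mul]; exact mul_mem ha0 hb0,
      by rw [map_mul]; exact mul_mem ha1 hb1, fun p => ?_⟩
    rw [dbl_mul]
    exact mul_mem (had _) (hbd _)
  inv_mem' := by
    rintro a ⟨ha, ha0, ha1, had⟩
    refine ⟨inv_mem ha, by rw [map_inv]; exact inv_mem ha0,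
      by rw [map_inv]; exact inv_mem ha1, fun p => ?_⟩
    rw [dbl_inv]
    exact inv_mem (had _)

theorem face_normal {n : ℕ} {N : Subgroup (Braid (n + 1))} (hN : N.Normal) : (face N).Normal where
  conj_mem := by
    rintro h ⟨hp, h0, h1, hd⟩ g
    refine ⟨(MonoidHom.normal_ker _).conj_mem h hp g, ?_, ?_, fun p => ?_⟩
    · rw [map_mul, map_mul, map_inv]; exact hN.conj_mem _ h0 _
    · rw [map_mul, map_mul, map_inv]; exact hN.conj_mem _ h1 _
    · rw [dbl_mul, dbl_mul, mem_PB.1 hp, dbl_inv, Equiv.Perm.one_apply]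
      exact hN.conj_mem _ (hd _) _

/-- The poset of the finite index normal subgroups of the braid group on `4` strands that are
contained in the pure braid group. -/
structure NFI where
  /-- the subgroup -/
  grp : Subgroup (Braid 4)
  normal : grp.Normal
  finiteIndex : grp.FiniteIndex
  le_PB : grp ≤ PB 4

/-- The subgroups `N_{PB_n}` attached to `N` for `n = 4, 3, 2` (for other `n` the trivial
subgroup; in arity `1` the braid group itself is trivial). -/
def NFI.sub (N : NFI) : (n : ℕ) → Subgroup (Braid n)
  | 4 => N.grp
  | 3 => face N.grp
  | 2 => face (face N.grp)
  | _ => ⊥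

theorem NFI.sub_normal (N : NFI) (n : ℕ) : (N.sub n).Normal := by
  unfold NFI.sub
  split
  · exact N.normal
  · exact face_normal N.normal
  · exact face_normal (face_normal N.normal)
  · infer_instance

theorem NFI.sub_le_PB (N : NFI) (n : ℕ) : N.sub n ≤ PB n := by
  unfold NFI.sub
  split
  · exact N.le_PB
  · exact fun h hh => hh.1
  · exact fun h hh => hh.1
  · exact bot_le

theorem braid_eq_one_of_le_one {n : ℕ} (hn : n ≤ 1) (g : Braid n) : g = 1 := by
  have : MonoidHom.id (Braid n) = 1 := Braid.hom_ext fun i hi => by omega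
  exact DFunLike.congr_fun this g

theorem NFI.sub_le_face (N : NFI) {n : ℕ} (hn : n + 1 ≤ 4) : N.sub n ≤ face (N.sub (n + 1)) := by
  match n, hn with
  | 0, _ => intro g _; rw [braid_eq_one_of_le_one (by omega) g]; exact one_mem _
  | 1, _ => intro g _; rw [braid_eq_one_of_le_one (by omega) g]; exact one_mem _
  | 2, _ => exact le_rfl
  | 3, _ => exact le_rfl

theorem NFI.cab_mem (N : NFI) {n k : ℕ} (h : n + k ≤ 4) (p : Fin n) {g : Braid n}
    (hg : g ∈ N.sub n) : cab k p g ∈ N.sub (n + k) := by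
  induction k with
  | zero => exact hg
  | succ k ih => exact (N.sub_le_face (n := n + k) h (ih (by omega))).2.2.2 _

theorem embed_embed {m M L : ℕ} (p q : ℕ) (h : p + m ≤ M) (h' : q + M ≤ L) (g : Braid m) :
    embed q h' (embed p h g) = embed (q + p) (by omega) g := by
  have : (embed q h').comp (embed p h) = embed (q + p) (by omega) :=
    Braid.hom_ext fun i hi => by simp [add_assoc]
  exact DFunLike.congr_fun this g

theorem embed_congr {m M : ℕ} {p q : ℕ} (e : p = q) (h : p + m ≤ M) (h' : q + m ≤ M) (g : Braid m) :
    embed p h g = embed q h' g := by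
  subst e
  rfl

theorem embed_self {m : ℕ} (h : 0 + m ≤ m) (g : Braid m) : embed 0 h g = g := by
  have : embed 0 h = MonoidHom.id (Braid m) := Braid.hom_ext fun i hi => by simp
  exact DFunLike.congr_fun this g

theorem NFI.embed_mem (N : NFI) {m M : ℕ} (hM : M ≤ 4) (p : ℕ) (hp : p + m ≤ M) {g : Braid m}
    (hg : g ∈ N.sub m) : embed p hp g ∈ N.sub M := by
  induction M generalizing p with
  | zero => rw [braid_eq_one_of_le_one (by omega) (embed p hp g)]; exact one_mem _
  | succ M ih =>
    by_cases hm : m = M + 1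
    · subst hm
      obtain rfl : p = 0 := by omega
      rw [embed_self]
      exact hg
    by_cases h : p + m ≤ M
    · have h2 := (N.sub_le_face hM (ih (by omega) p h)).2.1
      rw [embed_embed, embed_congr (Nat.zero_add p) _ hp] at h2
      exact h2
    · obtain ⟨q, rfl⟩ : ∃ q, p = 1 + q := ⟨p - 1, by omega⟩
      have h2 := (N.sub_le_face hM (ih (by omega) q (by omega))).2.2.1
      rw [embed_embed] at h2
      exact h2

/-- The equivalence relation on morphisms of parenthesized braids attached to `N`. -/
def NFI.rel (N : NFI) {n : ℕ} (a b : Obj n) : Setoid (Mor a b) where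
  r γ γ' := γ.braid⁻¹ * γ'.braid ∈ N.sub n
  iseqv :=
    { refl := fun γ => by rw [inv_mul_cancel]; exact one_mem _
      symm := fun {γ γ'} h => by simpa using inv_mem h
      trans := fun {γ γ' γ''} h h' => by simpa [mul_assoc] using mul_mem h h' }

theorem NFI.comp_rel (N : NFI) {n : ℕ} {a b c : Obj n} {γ γ' : Mor b c} {η η' : Mor a b}
    (hγ : N.rel b c γ γ') (hη : N.rel a b η η') : N.rel a c (γ.comp η) (γ'.comp η') := by
  change (γ.braid * η.braid)⁻¹ * (γ'.braid * η'.braid) ∈ N.sub n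
  have h1 := (N.sub_normal n).conj_mem _ hγ η.braid⁻¹
  have := mul_mem h1 hη
  convert! this using 1
  group

theorem NFI.ins_rel (N : NFI) {n k : ℕ} (h : n + k ≤ 4) {a b : Obj n} {c d : Obj (k + 1)}
    {γ γ' : Mor a b} {η η' : Mor c d} (i : Fin n)
    (hγ : N.rel a b γ γ') (hη : N.rel c d η η') :
    N.rel (a.ins i c) (b.ins i d) (γ.ins i η) (γ'.ins i η') := by
  set p := a.pos i
  change (cab k p γ.braid * embed p.1 _ η.braid)⁻¹ *
    (cab k p γ'.braid * embed p.1 _ η'.braid) ∈ N.sub (n + k)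
  have e1 : γ'.braid = γ.braid * (γ.braid⁻¹ * γ'.braid) := by group
  have e2 : η'.braid = η.braid * (η.braid⁻¹ * η'.braid) := by group
  have h0 := mem_PB.1 (N.sub_le_PB n hγ)
  have h1 := N.cab_mem h p hγ
  have h2 := N.embed_mem (m := k + 1) (M := n + k) h p.1 (by omega) hη
  rw [e1, e2, cab_mul, h0, map_mul, Equiv.Perm.one_apply]
  have h3 := (N.sub_normal (n + k)).conj_mem _ h1 (embed p.1 (by omega) η.braid)⁻¹
  have := mul_mem h3 h2
  convert! this using 1
  group

/-! ### Truncated operads and the groupoid of GT-shadows -/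

/-- The data of a `4`-truncated operad in the category of groupoids whose objects are those of the
operad of parenthesized braids: morphisms, identities, composition, the action of the symmetric
groups on morphisms, and the elementary insertions in arities `≤ 4`. There are two instances below,
the operad of parenthesized braids and its quotients. There are no objects in arity `0`. -/
structure TruncOperad where
  Hom : ∀ {n : ℕ}, Obj n → Obj n → Type
  id : ∀ {n : ℕ} (a : Obj n), Hom a a
  comp : ∀ {n : ℕ} {a b c : Obj n}, Hom b c → Hom a b → Hom a c
  act : ∀ {n : ℕ} {a b : Obj n} (θ : Equiv.Perm (Fin n)), Hom a b → Hom (a.act θ) (b.act θ)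
  ins : ∀ {n k : ℕ} (_ : n + k ≤ 4) {a b : Obj n} {c d : Obj (k + 1)} (_ : Hom a b) (i : Fin n)
    (_ : Hom c d), Hom (a.ins i c) (b.ins i d)

/-- Morphisms of truncated operads that are the identity on objects. -/
@[ext] structure TruncOperad.Map (A B : TruncOperad) where
  map : ∀ {n : ℕ} (_ : n ≤ 4) {a b : Obj n}, A.Hom a b → B.Hom a b
  map_id : ∀ {n : ℕ} (hn : n ≤ 4) (a : Obj n), map hn (A.id a) = B.id a
  map_comp : ∀ {n : ℕ} (hn : n ≤ 4) {a b c : Obj n} (γ : A.Hom b c) (η : A.Hom a b),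
    map hn (A.comp γ η) = B.comp (map hn γ) (map hn η)
  map_act : ∀ {n : ℕ} (hn : n ≤ 4) {a b : Obj n} (θ : Equiv.Perm (Fin n)) (γ : A.Hom a b),
    map hn (A.act θ γ) = B.act θ (map hn γ)
  map_ins : ∀ {n k : ℕ} (hn : n ≤ 4) (hk : k + 1 ≤ 4) (h : n + k ≤ 4) {a b : Obj n}
    {c d : Obj (k + 1)} (γ : A.Hom a b) (i : Fin n) (η : A.Hom c d),
    map h (A.ins h γ i η) = B.ins h (map hn γ) i (map hk η)

instance : Category TruncOperad where
  Hom A B := A.Map B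
  id A := ⟨fun _ _ _ γ => γ, fun _ _ => rfl, fun _ _ _ _ _ _ => rfl, fun _ _ _ _ _ => rfl,
    fun _ _ _ _ _ _ _ _ _ _ => rfl⟩
  comp F G :=
    { map := fun hn _ _ γ => G.map hn (F.map hn γ)
      map_id := fun hn a => by rw [F.map_id, G.map_id]
      map_comp := fun hn _ _ _ γ η => by rw [F.map_comp, G.map_comp]
      map_act := fun hn _ _ θ γ => by rw [F.map_act, G.map_act]
      map_ins := fun hn hk h _ _ _ _ γ i η => by rw [F.map_ins hn hk, G.map_ins hn hk] }

/-- The truncated operad of parenthesized braids. -/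
def PaB : TruncOperad where
  Hom := Mor
  id := Mor.id
  comp := Mor.comp
  act := Mor.act
  ins := fun _ _ _ _ _ γ i η => γ.ins i η

/-- The quotient of the truncated operad of parenthesized braids by the equivalence relation
attached to `N`. -/
def NFI.quot (N : NFI) : TruncOperad where
  Hom a b := Quotient (N.rel a b)
  id a := Quotient.mk _ (Mor.id a)
  comp := Quotient.map₂ Mor.comp fun _ _ h _ _ h' => N.comp_rel h h'
  act θ := Quotient.map (Mor.act θ) fun _ _ h => h
  ins h _ _ _ _ x i y :=
    Quotient.map₂ (fun γ η => Mor.ins γ i η) (fun _ _ hγ _ _ hη => N.ins_rel h i hγ hη) x y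

/-- The projection onto the quotient. -/
def NFI.proj (N : NFI) : PaB ⟶ N.quot :=
  { map := fun _ _ _ γ => Quotient.mk _ γ
    map_id := fun _ _ => rfl
    map_comp := fun _ _ _ _ _ _ => rfl
    map_act := fun _ _ _ _ _ => rfl
    map_ins := fun _ _ _ _ _ _ _ _ _ _ => rfl : TruncOperad.Map _ _ }

/-- The groupoid `GTSh` of GT-shadows: the morphisms from `N'` to `N` are the isomorphisms of
truncated operads from the quotient attached to `N'` to the quotient attached to `N`. -/
instance : Groupoid NFI where
  Hom N' N := N'.quot ≅ N.quot
  id _ := Iso.refl _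
  comp S T := S.trans T
  inv T := T.symm
  id_comp := Iso.refl_trans
  comp_id := Iso.trans_refl
  assoc := Iso.trans_assoc
  inv_comp := Iso.symm_self_id
  comp_inv := Iso.self_symm_id

/-- The isomorphism of truncated operads underlying a morphism of `GTSh`. -/
def toIso {N' N : NFI} (T : N' ⟶ N) : N'.quot ≅ N.quot := T

/-! ### GT-shadows as pairs -/

/-- The parenthesization `(⋯(1 2)⋯)` of `k + 1` letters. -/
def leftTree : ℕ → FreeMagma Unit
  | 0 => .of ()
  | k + 1 => leftTree k * .of ()

theorem length_leftTree (k : ℕ) : (leftTree k).length = k + 1 := by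
  induction k with
  | zero => rfl
  | succ k ih => change (leftTree k).length + 1 = _; rw [ih]

/-- The object `(⋯((1 2) 3)⋯) (k + 1)`. -/
def std (k : ℕ) : Obj (k + 1) := ⟨leftTree k, length_leftTree k, 1⟩

/-- The object `2 1`. -/
def obj21 : Obj 2 := ⟨.of () * .of (), rfl, Equiv.swap 0 1⟩

/-- The object `1 (2 3)`. -/
def obj1_23 : Obj 3 := ⟨.of () * (.of () * .of ()), rfl, 1⟩

/-- The braiding. -/
def β : Mor (std 1) obj21 := ⟨σ 0 (by omega), by
  rw [ρ_σ]; exact Equiv.swap_mul_self _ _⟩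

/-- The associator. -/
def α : Mor (std 2) obj1_23 := ⟨1, by rw [map_one]; rfl⟩

/-- A pure braid as an automorphism of the standard object. -/
def 𝔪 {k : ℕ} (g : PB (k + 1)) : Mor (std k) (std k) := ⟨g.1, by rw [mem_PB.1 g.2, mul_one]⟩

/-- The generators of the pure braid groups on two and on three strands. -/
def y12 : Braid 2 := σ 0 (by omega) ^ 2
def σ1 : Braid 3 := σ 0 (by omega)
def σ2 : Braid 3 := σ 1 (by omega)
def x12 : Braid 3 := σ1 ^ 2
def x23 : Braid 3 := σ2 ^ 2
def x13 : Braid 3 := σ2 * σ1 ^ 2 * σ2⁻¹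

/-- `y12` as an element of the pure braid group on two strands. -/
def y12' : PB 2 := ⟨y12, by
  rw [mem_PB, y12, map_pow, ρ_σ, pow_two]; exact Equiv.swap_mul_self _ _⟩

/-- The order `N_ord`: the index of `N_{PB_2}` in `PB_2`. -/
noncomputable def NFI.ord (N : NFI) : ℕ := (N.sub 2).relIndex (PB 2)

/-- Pairs consisting of a residue class modulo `N_ord` and a coset of `N_{PB_3}` in `PB_3`. -/
abbrev NFI.Pair (N : NFI) : Type := ZMod N.ord × (PB 3 ⧸ (N.sub 3).subgroupOf (PB 3))

/-- The pair represented by `(m, f)`. -/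
noncomputable def NFI.pair (N : NFI) (m : ℤ) (f : PB 3) : N.Pair := (m, QuotientGroup.mk f)

/-- `(m, f)` represents a GT-pair: it satisfies the two hexagon relations in `B_3 / N_{PB_3}` and
the pentagon relation in `B_4 / N`. -/
structure NFI.IsGTPair (N : NFI) (m : ℤ) (f : PB 3) : Prop where
  hexagon₁ : (QuotientGroup.mk (σ1 * x12 ^ m * f.1⁻¹ * σ2 * x23 ^ m * f.1) : Braid 3 ⧸ N.sub 3) =
    QuotientGroup.mk (f.1⁻¹ * σ1 * σ2 * (x13 * x23) ^ m)
  hexagon₂ : (QuotientGroup.mk (f.1⁻¹ * σ2 * x23 ^ m * f.1 * σ1 * x12 ^ m) : Braid 3 ⧸ N.sub 3) =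
    QuotientGroup.mk (σ2 * σ1 * (x12 * x13) ^ m * f.1)
  pentagon : (QuotientGroup.mk (embed 1 (by omega) f.1 * dbl 1 f.1 * embed 0 (by omega) f.1) :
    Braid 4 ⧸ N.grp) = QuotientGroup.mk (dbl 2 f.1 * dbl 0 f.1)

/-- `T` is the morphism of truncated operads `T_{m,f}` of a GT-pair `p = [(m, f)]`, that is, it
sends the associator to the class of `α · 𝔪(f)` and the braiding to the class of
`β · 𝔪(x₁₂ ^ m)`. -/
def NFI.IsMorOf (N : NFI) (T : PaB ⟶ N.quot) (p : N.Pair) : Prop :=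
  ∃ (m : ℤ) (f : PB 3), p = N.pair m f ∧ N.IsGTPair m f ∧
    T.map (by omega) α = Quotient.mk _ (α.comp (𝔪 f)) ∧
    T.map (by omega) β = Quotient.mk _ (β.comp (𝔪 (y12' ^ m)))

/-- The coset in `B_n / N_{PB_n}` underlying a morphism of the quotient operad. -/
def NFI.ou (N : NFI) {n : ℕ} {a b : Obj n} : Quotient (N.rel a b) → Braid n ⧸ N.sub n :=
  Quotient.lift (fun γ => QuotientGroup.mk γ.braid) fun _ _ h => QuotientGroup.eq.2 h

/-- The map `T^{PB_n}` from `PB_n` to `B_n / N_{PB_n}` induced by `T`, where `n = k + 1`. Its values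
lie in `PB_n / N_{PB_n}`. -/
def NFI.onPB (N : NFI) (T : PaB ⟶ N.quot) {k : ℕ} (hk : k + 1 ≤ 4) (g : PB (k + 1)) :
    Braid (k + 1) ⧸ N.sub (k + 1) :=
  N.ou (T.map hk (𝔪 g))

/-- `T^{PB_n}` maps onto `PB_n / N_{PB_n}`, where `n = k + 1`. -/
def NFI.Onto (N : NFI) (T : PaB ⟶ N.quot) {k : ℕ} (hk : k + 1 ≤ 4) : Prop :=
  ∀ h : PB (k + 1), ∃ g : PB (k + 1), N.onPB T hk g = QuotientGroup.mk h.1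

/-- The set `GT(N)` of GT-shadows with target `N`. -/
def NFI.GT (N : NFI) : Set N.Pair :=
  {p | ∃ T : PaB ⟶ N.quot, N.IsMorOf T p ∧
    N.Onto T (k := 1) (by omega) ∧ N.Onto T (k := 2) (by omega) ∧ N.Onto T (k := 3) (by omega)}

/-- The free group on `x₁₂` and `x₂₃`, as a subgroup of the braid group on three strands. -/
def F₂ : Subgroup (Braid 3) := Subgroup.closure {x12, x23}

/-- The set of charming GT-shadows with target `N`: the coset of `f` can be represented by an
element of `[F₂, F₂]`, and the restriction of `T^{PB_3}` to `F₂` maps onto `F₂ / (N_{PB_3} ∩ F₂)`. -/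
def NFI.GTCharm (N : NFI) : Set N.Pair :=
  {p | p ∈ N.GT ∧ (∃ f : PB 3, f.1 ∈ ⁅F₂, F₂⁆ ∧ p.2 = QuotientGroup.mk f) ∧
    ∃ T : PaB ⟶ N.quot, N.IsMorOf T p ∧
      ∀ h ∈ F₂, ∃ g : PB 3, g.1 ∈ F₂ ∧ N.onPB T (k := 2) (by omega) g = QuotientGroup.mk h}

/-- The charming GT-shadows with target `N` and with source `N'`, the source being the kernel of
`T^{PB_4}`. -/
def charmHom (N' N : NFI) : Set N.Pair :=
  {p | p ∈ N.GTCharm ∧ ∃ T : PaB ⟶ N.quot, N.IsMorOf T p ∧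
    ∀ g : Braid 4, g ∈ N'.grp ↔
      ∃ hg : g ∈ PB 4, N.onPB T (k := 3) (by omega) ⟨g, hg⟩ = QuotientGroup.mk 1}

/-- The isomorphism of truncated operads `T` from the quotient attached to `N'` to the one attached
to `N` corresponds to the GT-pair `p`, that is, the composite of the projection and of `T` is the
morphism of truncated operads of `p`. -/
def Represents {N' N : NFI} (T : N' ⟶ N) (p : N.Pair) : Prop :=
  N.IsMorOf (N'.proj ≫ (toIso T).hom) p

end GTShadow

namespace GTShadow

open CategoryTheory

/-! The GT-shadow conditions are translated into properties of the morphism of truncated operads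
itself, where composition and inversion are easy to follow. By equivariance under relabelling, a
morphism T acts on pairs (change of parenthesization, braid); `NFI.Sends` records this action as a
relation between representing braids, multiplicative and compatible with insertion.

Every T has a pair (m, f): its value on α is a pure braid f, and its value on β is σ₁ times a pure
braid of B₂, hence a power of y₁₂. The hexagons and the pentagon then hold automatically, because
each compares two factorizations of one morphism (`isGTPair`). The pair is unique, and it determines
T, since α and β generate (`NFI.agree_of_αβ`). So pairs and morphisms can be exchanged freely. The
converse, that every GT-pair defines a morphism, is never used, because T is part of the data.

If T is onto in arities 2, 3, 4 and has kernel N' in arity 4, then its kernels in lower arities are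
the iterated faces of N' (`iff_mem_face`), and T descends to an isomorphism from the quotient by N'.
Conversely, an isomorphism composed with the projection is full with kernel N'. Hence an isomorphism
corresponds to a charming GT-shadow exactly when it is `NFI.Charming`: f can be taken in [F₂, F₂],
and F₂ is reached from F₂.

Closure rests on one fact: T maps F₂ into F₂ modulo N when f lies in F₂ (`HasPair.sends_F₂`). The f
of a composite is f₂ · T₂(f₁), which stays in [F₂, F₂]. For an inverse, surjectivity on F₂ lifts f⁻¹
to some x in [F₂, F₂]; then T sends the associator twisted by x to α itself, so x serves as the f of
the inverse. -/

/-! ### The action of a morphism of truncated operads on braids -/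

/-- The morphism `T` maps the morphisms with underlying braid `g` from the parenthesization `t` to
the parenthesization `t'`, for any labels, to the classes of the morphisms with underlying braid
`g'`. -/
def NFI.Sends {N : NFI} (T : PaB ⟶ N.quot) {n : ℕ} (hn : n ≤ 4) (t t' : FreeMagma Unit)
    (g g' : Braid n) : Prop :=
  ∃ (a b : Obj n) (γ γ' : Mor a b), a.tree = t ∧ b.tree = t' ∧ γ.braid = g ∧ γ'.braid = g' ∧
    T.map hn γ = Quotient.mk (N.rel a b) γ'

namespace NFI.Sends

variable {N : NFI} {T : PaB ⟶ N.quot} {n : ℕ} {hn : n ≤ 4} {t t' t'' : FreeMagma Unit}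
  {g g' g₁ g₂ h h' : Braid n}

/-- Two morphisms with the same braid and the same source and target parenthesizations differ by a
relabelling, and T is equivariant. Hence one labelled instance gives all of them. -/
theorem mor (hs : Sends T hn t t' g g') {a b : Obj n} (ha : a.tree = t) (hb : b.tree = t')
    (γ : Mor a b) (hγ : γ.braid = g) :
    ∃ γ' : Mor a b, γ'.braid = g' ∧ T.map hn γ = Quotient.mk (N.rel a b) γ' := by
  obtain ⟨a₀, b₀, γ₀, γ₀', rfl, rfl, rfl, rfl, e⟩ := hs
  obtain ⟨θ, rfl⟩ : ∃ θ, a = a₀.act θ := ⟨a.lab * a₀.lab⁻¹, Obj.ext ha (by simp [Obj.act])⟩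
  -- The labels of the target are forced by those of the source and by the permutation of the braid.
  obtain rfl : b = b₀.act θ := Obj.ext hb (by
    have h1 := γ.lab_eq
    have h2 := γ₀.lab_eq
    rw [hγ] at h1
    rw [← mul_left_inj (ρ γ₀.braid), h1]
    change θ * a₀.lab = θ * b₀.lab * _
    rw [mul_assoc, h2])
  obtain rfl : γ = γ₀.act θ := Mor.ext hγ
  refine ⟨γ₀'.act θ, rfl, ?_⟩
  refine (T.map_act hn θ γ₀).trans ?_
  rw [e]
  rfl

theorem length_left (hs : Sends T hn t t' g g') : t.length = n := by
  obtain ⟨a, b, γ, γ', rfl, -⟩ := hs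
  exact a.length_tree

theorem length_right (hs : Sends T hn t t' g g') : t'.length = n := by
  obtain ⟨a, b, γ, γ', -, rfl, -⟩ := hs
  exact b.length_tree

theorem perm_eq (hs : Sends T hn t t' g g') : ρ g' = ρ g := by
  obtain ⟨a, b, γ, γ', -, -, rfl, rfl, -⟩ := hs
  exact mul_left_cancel (γ'.lab_eq.trans γ.lab_eq.symm)

theorem one (ht : t.length = n) : Sends T hn t t 1 1 :=
  ⟨⟨t, ht, 1⟩, ⟨t, ht, 1⟩, Mor.id _, Mor.id _, rfl, rfl, rfl, rfl, T.map_id hn _⟩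

theorem comp (h₁ : Sends T hn t' t'' g g') (h₂ : Sends T hn t t' h h') :
    Sends T hn t t'' (g * h) (g' * h') := by
  have hl := h₂.length_left
  obtain ⟨b, c, γ, γ', hb, hc, rfl, rfl, e⟩ := h₁
  let η : Mor ⟨t, hl, b.lab * ρ h⟩ b := ⟨h, rfl⟩
  obtain ⟨η', rfl, e'⟩ := h₂.mor rfl hb η rfl
  refine ⟨_, c, γ.comp η, γ'.comp η', rfl, hc, rfl, rfl, ?_⟩
  refine (T.map_comp hn γ η).trans ?_
  rw [e, e']
  rfl

theorem total (T : PaB ⟶ N.quot) (hn : n ≤ 4) (ht : t.length = n) (ht' : t'.length = n)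
    (g : Braid n) : ∃ g', Sends T hn t t' g g' := by
  let γ : Mor ⟨t, ht, ρ g⟩ ⟨t', ht', 1⟩ := ⟨g, one_mul _⟩
  obtain ⟨γ', e⟩ := Quotient.exists_rep (T.map hn γ)
  exact ⟨_, _, _, γ, γ', rfl, rfl, rfl, rfl, e.symm⟩

theorem unique (h₁ : Sends T hn t t' g g₁) (h₂ : Sends T hn t t' g g₂) :
    g₁⁻¹ * g₂ ∈ N.sub n := by
  obtain ⟨a, b, γ, γ', ha, hb, rfl, rfl, e⟩ := h₁
  obtain ⟨γ'', rfl, e'⟩ := h₂.mor ha hb γ rfl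
  exact Quotient.exact (e.symm.trans e')

theorem congr (h₁ : Sends T hn t t' g g₁) (h₂ : g₁⁻¹ * g₂ ∈ N.sub n) :
    Sends T hn t t' g g₂ := by
  obtain ⟨a, b, γ, γ', ha, hb, rfl, rfl, e⟩ := h₁
  -- `N.sub n` consists of pure braids, so `g₂` connects the same labels and is a morphism from `a`
  -- to `b`.
  have hρ : ρ g₂ = ρ γ'.braid := by
    have := mem_PB.1 (N.sub_le_PB n h₂)
    rw [map_mul, map_inv, inv_mul_eq_one] at this
    exact this.symm
  refine ⟨a, b, γ, ⟨g₂, hρ ▸ γ'.lab_eq⟩, ha, hb, rfl, rfl, e.trans ?_⟩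
  exact Quotient.sound h₂

/-- Morphisms of truncated operads are only required to preserve composites and identities; the
image of the inverse is taken arbitrarily and then pinned down by uniqueness. -/
theorem inv (hs : Sends T hn t t' g g') : Sends T hn t' t g⁻¹ g'⁻¹ := by
  obtain ⟨x, hx⟩ := total T hn hs.length_right hs.length_left g⁻¹
  refine hx.congr ?_
  have h₁ := hs.comp hx
  rw [mul_inv_cancel] at h₁
  simpa using h₁.unique (one hs.length_right)

theorem ins {k : ℕ} {hk : k + 1 ≤ 4} {s s' u u' : FreeMagma Unit} {x x' : Braid (k + 1)}
    (hs : Sends T hn t t' g g') (hx : Sends T hk s s' x x') (hnk : n + k ≤ 4) (p : Fin n)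
    (hu : graft t p s = u) (hu' : graft t' (ρ g p) s' = u') :
    Sends T hnk u u' (insBraid k g p x) (insBraid k g' p x') := by
  obtain ⟨a, b, γ, γ', rfl, rfl, rfl, rfl, e⟩ := hs
  obtain ⟨c, d, η, η', rfl, rfl, rfl, rfl, e'⟩ := hx
  -- Insertion in the operad is indexed by labels, the relation by positions: the label at `p` in
  -- the source sits at `ρ g p` in the target.
  have hp : a.pos (a.lab p) = p := a.lab.symm_apply_apply p
  refine ⟨a.ins (a.lab p) c, b.ins (a.lab p) d, γ.ins _ η, γ'.ins _ η', ?_, ?_, ?_, ?_, ?_⟩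
  · rw [← hu]; change graft _ (a.pos (a.lab p)) _ = _; rw [hp]
  · rw [← hu']; change graft _ (b.pos (a.lab p)) _ = _; rw [← γ.pos_eq, hp]
  · change insBraid k _ (a.pos (a.lab p)) _ = _; rw [hp]
  · change insBraid k _ (a.pos (a.lab p)) _ = _; rw [hp]
  · refine (T.map_ins hn hk hnk γ _ η).trans ?_
    rw [e, e']
    rfl

theorem ins_one {k : ℕ} {hk : k + 1 ≤ 4} {s s' u u' : FreeMagma Unit} {x x' : Braid (k + 1)}
    (hs : Sends T hn t t' 1 g') (hx : Sends T hk s s' x x') (hnk : n + k ≤ 4) (p : Fin n)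
    (hu : graft t p s = u) (hu' : graft t' p s' = u') :
    Sends T hnk u u' (insBraid k 1 p x) (insBraid k g' p x') :=
  hs.ins hx hnk p hu (by rw [map_one]; exact hu')

end NFI.Sends

theorem NFI.Sends.of_map {N : NFI} {T : PaB ⟶ N.quot} {n : ℕ} {hn : n ≤ 4} {a b : Obj n}
    {γ γ' : Mor a b} (h : T.map hn γ = Quotient.mk (N.rel a b) γ') :
    Sends T hn a.tree b.tree γ.braid γ'.braid :=
  ⟨a, b, γ, γ', rfl, rfl, rfl, rfl, h⟩

theorem NFI.Sends.map_eq {N : NFI} {T : PaB ⟶ N.quot} {n : ℕ} {hn : n ≤ 4} {a b : Obj n}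
    {γ γ' : Mor a b} (h : Sends T hn a.tree b.tree γ.braid γ'.braid) :
    T.map hn γ = Quotient.mk (N.rel a b) γ' := by
  obtain ⟨γ'', hγ, e⟩ := h.mor rfl rfl γ rfl
  rwa [Mor.ext hγ] at e

theorem insBraid_one_left {n : ℕ} (k : ℕ) (p : Fin n) (h : Braid (k + 1)) :
    insBraid k 1 p h = embed p.1 (by omega) h := by
  rw [insBraid, cab_one, one_mul]

theorem insBraid_one_right {n : ℕ} (p : Fin n) (g : Braid n) : insBraid 1 g p 1 = dbl p g := by
  rw [insBraid, map_one, mul_one]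
  rfl

/-! ### Parenthesizations of at most four letters -/

local notation "⋆" => (FreeMagma.of () : FreeMagma Unit)

theorem tree_length_pos (t : FreeMagma Unit) : 0 < t.length := by
  induction t with
  | ih1 _ => exact Nat.one_pos
  | ih2 a b iha ihb => exact Nat.add_pos_left iha _

theorem tree_cases (t : FreeMagma Unit) :
    t = ⋆ ∨ ∃ a b : FreeMagma Unit, t = a * b ∧ t.length = a.length + b.length := by
  cases t with
  | of _ => exact Or.inl rfl
  | mul a b => exact Or.inr ⟨a, b, rfl, rfl⟩

theorem tree_length_star : (⋆).length = 1 := rfl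

theorem tree_one {t : FreeMagma Unit} (ht : t.length = 1) : t = ⋆ := by
  obtain rfl | ⟨a, b, -, h⟩ := tree_cases t
  · rfl
  · have := tree_length_pos a
    have := tree_length_pos b
    omega

theorem tree_two {t : FreeMagma Unit} (ht : t.length = 2) : t = ⋆ * ⋆ := by
  obtain rfl | ⟨a, b, rfl, h⟩ := tree_cases t
  · rw [tree_length_star] at ht; omega
  · have := tree_length_pos a
    have := tree_length_pos b
    rw [tree_one (t := a) (by omega), tree_one (t := b) (by omega)]

theorem tree_three {t : FreeMagma Unit} (ht : t.length = 3) :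
    t = ⋆ * ⋆ * ⋆ ∨ t = ⋆ * (⋆ * ⋆) := by
  obtain rfl | ⟨a, b, rfl, h⟩ := tree_cases t
  · rw [tree_length_star] at ht; omega
  · have := tree_length_pos a
    have := tree_length_pos b
    obtain h1 | h1 : a.length = 1 ∨ a.length = 2 := by omega
    · rw [tree_one h1, tree_two (t := b) (by omega)]; exact Or.inr rfl
    · rw [tree_two h1, tree_one (t := b) (by omega)]; exact Or.inl rfl

theorem tree_four {t : FreeMagma Unit} (ht : t.length = 4) :
    t = ⋆ * ⋆ * ⋆ * ⋆ ∨ t = ⋆ * (⋆ * ⋆) * ⋆ ∨ t = ⋆ * (⋆ * ⋆ * ⋆) ∨ t = ⋆ * (⋆ * (⋆ * ⋆)) ∨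
      t = ⋆ * ⋆ * (⋆ * ⋆) := by
  obtain rfl | ⟨a, b, rfl, h⟩ := tree_cases t
  · rw [tree_length_star] at ht; omega
  · have := tree_length_pos a
    have := tree_length_pos b
    obtain h1 | h1 | h1 : a.length = 1 ∨ a.length = 2 ∨ a.length = 3 := by omega
    · rw [tree_one h1]
      obtain h2 | h2 := tree_three (t := b) (by omega) <;> rw [h2] <;> simp
    · rw [tree_two h1, tree_two (t := b) (by omega)]; simp
    · rw [tree_one (t := b) (by omega)]
      obtain h2 | h2 := tree_three (t := a) (by omega) <;> rw [h2] <;> simp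

/-! ### Generation by the associator and the braiding -/

/-- The morphisms `T` and `T'` agree on the braid `g` from the parenthesization `t` to the
parenthesization `t'`. -/
def NFI.Agree {N : NFI} (T T' : PaB ⟶ N.quot) {n : ℕ} (hn : n ≤ 4) (t t' : FreeMagma Unit)
    (g : Braid n) : Prop :=
  ∃ g', Sends T hn t t' g g' ∧ Sends T' hn t t' g g'

namespace NFI.Agree

variable {N : NFI} {T T' : PaB ⟶ N.quot} {n : ℕ} {hn : n ≤ 4} {t t' t'' : FreeMagma Unit}
  {g h : Braid n}

theorem one (ht : t.length = n) : Agree T T' hn t t 1 := ⟨1, .one ht, .one ht⟩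

theorem comp : Agree T T' hn t' t'' g → Agree T T' hn t t' h → Agree T T' hn t t'' (g * h) :=
  fun ⟨_, h₁, h₁'⟩ ⟨_, h₂, h₂'⟩ => ⟨_, h₁.comp h₂, h₁'.comp h₂'⟩

theorem inv : Agree T T' hn t t' g → Agree T T' hn t' t g⁻¹ :=
  fun ⟨_, h, h'⟩ => ⟨_, h.inv, h'.inv⟩

theorem ins_one {k : ℕ} {hk : k + 1 ≤ 4} {s s' u u' : FreeMagma Unit} {x : Braid (k + 1)} :
    Agree T T' hn t t' 1 → Agree T T' hk s s' x → ∀ (hnk : n + k ≤ 4) (p : Fin n)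
    (_ : graft t p s = u) (_ : graft t' p s' = u'),
    Agree T T' hnk u u' (insBraid k 1 p x) :=
  fun ⟨_, h, h'⟩ ⟨_, hx, hx'⟩ hnk p hu hu' =>
    ⟨_, h.ins_one hx hnk p hu hu', h'.ins_one hx' hnk p hu hu'⟩

theorem trans_one (h₁ : Agree T T' hn t t' 1) (h₂ : Agree T T' hn t' t'' 1) :
    Agree T T' hn t t'' 1 := by simpa using h₂.comp h₁

theorem symm_one (h₁ : Agree T T' hn t t' 1) : Agree T T' hn t' t 1 := by simpa using h₁.inv

/-- If `T` and `T'` agree on all changes of parenthesization, and on each Artin generator for some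
parenthesizations, then they agree everywhere. -/
theorem of_gen (s : FreeMagma Unit) (hs : ∀ t, t.length = n → Agree T T' hn s t 1)
    (hσ : ∀ i (hi : i + 1 < n), ∃ t t', Agree T T' hn t t' (σ i hi)) (ht : t.length = n)
    (ht' : t'.length = n) (g : Braid n) : Agree T T' hn t t' g := by
  induction g using Braid.induction generalizing t t' with
  | one => exact (hs t ht).symm_one.trans_one (hs t' ht')
  | gen i hi =>
    obtain ⟨u, u', h⟩ := hσ i hi
    have hu := h.choose_spec.1.length_left
    have hu' := h.choose_spec.1.length_right
    -- Reparenthesize from `t` to `u` through `s`, apply the generator there, and go back from `u'`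
    -- to `t'` in the same way.
    have h₁ := (hs t ht).symm_one.trans_one (hs u hu)
    have h₂ := (hs u' hu').symm_one.trans_one (hs t' ht')
    simpa using h₂.comp (h.comp h₁)
  | mul g h hg hh => exact (hg ht ht').comp (hh ht ht)
  | inv g hg => exact (hg ht' ht).inv

end NFI.Agree

theorem insBraid_one_one {n : ℕ} (p : Fin n) : insBraid 1 (1 : Braid n) p 1 = 1 := by
  rw [insBraid_one_right, dbl_one]

/-- Two morphisms that agree on the associator and on the braiding agree everywhere. -/
theorem NFI.agree_of_αβ {N : NFI} {T T' : PaB ⟶ N.quot}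
    (hα : Agree T T' (n := 3) (by omega) (⋆ * ⋆ * ⋆) (⋆ * (⋆ * ⋆)) 1)
    (hβ : Agree T T' (n := 2) (by omega) (⋆ * ⋆) (⋆ * ⋆) (σ 0 (by omega)))
    {n : ℕ} (hn : n ≤ 4) {t t' : FreeMagma Unit} (ht : t.length = n) (ht' : t'.length = n)
    (g : Braid n) : Agree T T' hn t t' g := by
  have one₂ : Agree T T' (n := 2) (by omega) (⋆ * ⋆) (⋆ * ⋆) 1 := .one rfl
  have one₂' : Agree T T' (n := 1 + 1) (by omega) (⋆ * ⋆) (⋆ * ⋆) 1 := .one rfl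
  -- Inserting the braiding into either slot of the identity of a two-letter word gives each Artin
  -- generator of B₃ on one parenthesization.
  have a₀ := one₂.ins_one (k := 1) hβ (by omega) 0 rfl rfl
  have a₁ := one₂.ins_one (k := 1) hβ (by omega) 1 rfl rfl
  rw [insBraid_one_left, embed_σ] at a₀ a₁
  obtain rfl | rfl | rfl | rfl | rfl : n = 0 ∨ n = 1 ∨ n = 2 ∨ n = 3 ∨ n = 4 := by omega
  · exact absurd ht (tree_length_pos t).ne'
  · rw [tree_one ht, tree_one ht', braid_eq_one_of_le_one le_rfl g]
    exact .one rfl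
  · refine .of_gen (⋆ * ⋆) (fun t ht => ?_) (fun i hi => ?_) ht ht' g
    · rw [tree_two ht]; exact one₂
    · obtain rfl : i = 0 := by omega
      exact ⟨_, _, hβ⟩
  · refine .of_gen (⋆ * ⋆ * ⋆) (fun t ht => ?_) (fun i hi => ?_) ht ht' g
    · obtain rfl | rfl := tree_three ht
      exacts [.one rfl, hα]
    · obtain rfl | rfl : i = 0 ∨ i = 1 := by omega
      exacts [⟨_, _, a₀⟩, ⟨_, _, a₁⟩]
  · have b₀ := one₂.ins_one (k := 2) a₀ (by omega) 0 rfl rfl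
    have b₁ := one₂.ins_one (k := 2) a₁ (by omega) 0 rfl rfl
    have b₂ := one₂.ins_one (k := 2) a₁ (by omega) 1 rfl rfl
    -- The five edges of the pentagon: the associator placed in one slot of a two-letter word, and
    -- the associator with one of its strands doubled.
    have c₀ := one₂.ins_one (k := 2) hα (by omega) 0 rfl rfl
    have c₁ := one₂.ins_one (k := 2) hα (by omega) 1 rfl rfl
    have d₀ := hα.ins_one one₂' (by omega) 0 rfl rfl
    have d₁ := hα.ins_one one₂' (by omega) 1 rfl rfl
    have d₂ := hα.ins_one one₂' (by omega) 2 rfl rfl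
    simp only [insBraid_one_one] at d₀ d₁ d₂
    simp only [insBraid_one_left, embed_σ, map_one] at b₀ b₁ b₂ c₀ c₁
    refine .of_gen (⋆ * ⋆ * ⋆ * ⋆) (fun t ht => ?_) (fun i hi => ?_) ht ht' g
    · obtain rfl | rfl | rfl | rfl | rfl := tree_four ht
      -- Four of the pentagon's edges already connect the leftmost parenthesization to the other
      -- four vertices.
      exacts [.one rfl, c₀, c₀.trans_one d₁, d₀.trans_one d₂, d₀]
    · obtain rfl | rfl | rfl : i = 0 ∨ i = 1 ∨ i = 2 := by omega
      exacts [⟨_, _, b₀⟩, ⟨_, _, b₁⟩, ⟨_, _, b₂⟩]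

/-! ### The braid group on two strands -/

theorem braid_two_eq_zpow (g : Braid 2) : ∃ k : ℤ, g = σ 0 (by omega) ^ k := by
  induction g using Braid.induction with
  | one => exact ⟨0, (zpow_zero _).symm⟩
  | gen i hi =>
    obtain rfl : i = 0 := by omega
    exact ⟨1, (zpow_one _).symm⟩
  | mul g h hg hh =>
    obtain ⟨k, rfl⟩ := hg
    obtain ⟨l, rfl⟩ := hh
    exact ⟨k + l, (zpow_add _ _ _).symm⟩
  | inv g hg =>
    obtain ⟨k, rfl⟩ := hg
    exact ⟨-k, (zpow_neg _ _).symm⟩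

/-- B₂ is cyclic, and an odd power of its generator exchanges the two strands. -/
theorem PB_two_eq_zpow {g : Braid 2} (hg : g ∈ PB 2) : ∃ m : ℤ, g = y12 ^ m := by
  obtain ⟨k, rfl⟩ := braid_two_eq_zpow g
  obtain ⟨m, rfl | rfl⟩ := Int.even_or_odd' k
  · exact ⟨m, by rw [zpow_mul]; rfl⟩
  · have hy : ρ (y12 ^ m) = 1 := mem_PB.1 (zpow_mem y12'.2 m)
    rw [mem_PB, zpow_add, zpow_mul, map_mul, zpow_one, ρ_σ] at hg
    rw [show (σ 0 _ : Braid 2) ^ (2 : ℤ) = y12 from rfl, hy, one_mul] at hg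
    exact absurd (congrArg (fun s => (s 0).1) hg) (by simp [adj_val])

theorem y12'_val (m : ℤ) : ((y12' ^ m : PB 2) : Braid 2) = y12 ^ m := by
  rw [Subgroup.coe_zpow]; rfl

/-- The quotient of PB₂ is cyclic, generated by the class of y₁₂, so the order of that class is the
index. -/
theorem NFI.y12_zpow_mem (N : NFI) (m : ℤ) : y12 ^ m ∈ N.sub 2 ↔ (N.ord : ℤ) ∣ m := by
  have := N.sub_normal 2
  let q : PB 2 ⧸ (N.sub 2).subgroupOf (PB 2) := QuotientGroup.mk y12'
  have hq : ∀ x, x ∈ Subgroup.zpowers q := by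
    intro x
    obtain ⟨⟨g, hg⟩, rfl⟩ := QuotientGroup.mk_surjective x
    obtain ⟨k, rfl⟩ := PB_two_eq_zpow hg
    refine ⟨k, ?_⟩
    change (QuotientGroup.mk (y12' ^ k) : PB 2 ⧸ _) = _
    exact congrArg _ (Subtype.ext (y12'_val k))
  have ho : orderOf q = N.ord := orderOf_eq_card_of_forall_mem_zpowers hq
  rw [← ho, orderOf_dvd_iff_zpow_eq_one]
  change _ ↔ (QuotientGroup.mk (y12' ^ m) : PB 2 ⧸ _) = 1
  rw [QuotientGroup.eq_one_iff, Subgroup.mem_subgroupOf, y12'_val]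

theorem NFI.pair_eq_iff (N : NFI) {m m' : ℤ} {f f' : PB 3} :
    N.pair m f = N.pair m' f' ↔ y12 ^ (m' - m) ∈ N.sub 2 ∧ f.1⁻¹ * f'.1 ∈ N.sub 3 := by
  rw [NFI.pair, NFI.pair, Prod.mk.injEq, QuotientGroup.eq, Subgroup.mem_subgroupOf,
    N.y12_zpow_mem, ZMod.intCast_eq_intCast_iff_dvd_sub]
  rfl

/-! ### The pair of a morphism -/

/-- The morphism `T` sends the associator and the braiding to the classes given by `(m, f)`. -/
structure NFI.HasPair {N : NFI} (T : PaB ⟶ N.quot) (m : ℤ) (f : Braid 3) : Prop where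
  assoc : Sends T (n := 3) (by omega) (⋆ * ⋆ * ⋆) (⋆ * (⋆ * ⋆)) 1 f
  braiding : Sends T (n := 2) (by omega) (⋆ * ⋆) (⋆ * ⋆) (σ 0 (by omega))
    (σ 0 (by omega) * y12 ^ m)

namespace NFI.HasPair

variable {N : NFI} {T : PaB ⟶ N.quot} {m : ℤ} {f : Braid 3}

theorem mem_PB (hT : HasPair T m f) : f ∈ PB 3 :=
  GTShadow.mem_PB.2 (hT.assoc.perm_eq.trans (map_one ρ))

theorem σ1_sends (hT : HasPair T m f) :
    Sends T (n := 3) (by omega) (⋆ * ⋆ * ⋆) (⋆ * ⋆ * ⋆) σ1 (σ1 * x12 ^ m) := by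
  have one₂ : Sends T (n := 2) (by omega) (⋆ * ⋆) (⋆ * ⋆) 1 1 := .one rfl
  have h := one₂.ins_one (k := 1) hT.braiding (by omega) 0 rfl rfl
  simp only [insBraid_one_left, map_mul, map_zpow, y12, map_pow, embed_σ] at h
  exact h

theorem σ2_sends_right (hT : HasPair T m f) :
    Sends T (n := 3) (by omega) (⋆ * (⋆ * ⋆)) (⋆ * (⋆ * ⋆)) σ2 (σ2 * x23 ^ m) := by
  have one₂ : Sends T (n := 2) (by omega) (⋆ * ⋆) (⋆ * ⋆) 1 1 := .one rfl
  have h := one₂.ins_one (k := 1) hT.braiding (by omega) 1 rfl rfl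
  simp only [insBraid_one_left, map_mul, map_zpow, y12, map_pow, embed_σ] at h
  exact h

/-- On `⋆ * ⋆ * ⋆` the last two letters are not grouped, so σ₂ is conjugated by the associator; this
is where f enters. -/
theorem σ2_sends (hT : HasPair T m f) :
    Sends T (n := 3) (by omega) (⋆ * ⋆ * ⋆) (⋆ * ⋆ * ⋆) σ2 (f⁻¹ * (σ2 * x23 ^ m) * f) := by
  simpa using (hT.assoc.inv.comp hT.σ2_sends_right).comp hT.assoc

end NFI.HasPair

theorem σ1_σ2_braid : σ1 * σ2 * σ1 = σ2 * σ1 * σ2 := σ_braid _ _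

/-- Doubling is only a crossed homomorphism on B₂, but it is multiplicative on pure braids, where
the doubled position does not move. -/
theorem dbl_y12_zpow (p : Fin 2) (m : ℤ) : dbl p (y12 ^ m) = dbl p y12 ^ m := by
  have hy : ∀ m : ℤ, ρ (y12 ^ m) = 1 := fun m => mem_PB.1 (zpow_mem y12'.2 m)
  let F : Multiplicative ℤ →* Braid 3 :=
    { toFun := fun k => dbl p (y12 ^ k.toAdd)
      map_one' := by rw [toAdd_one, zpow_zero, dbl_one]
      map_mul' := fun a b => by
        rw [toAdd_mul, zpow_add, dbl_mul, hy, Equiv.Perm.one_apply] }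
  have := map_zpow F (Multiplicative.ofAdd 1) m
  rw [← ofAdd_zsmul, smul_eq_mul, mul_one] at this
  simpa [F] using this

theorem dbl_zero_y12 : dbl (0 : Fin 2) y12 = x13 * x23 := by
  rw [y12, pow_two, dbl_mul, dbl_σ, dbl_σ, ρ_σ]
  change (σ2 * σ1) * (σ1 * σ2) = _
  rw [x13, x23, pow_two, pow_two]
  group

theorem dbl_one_y12 : dbl (1 : Fin 2) y12 = x12 * x13 := by
  rw [y12, pow_two, dbl_mul, dbl_σ, dbl_σ, ρ_σ]
  change (σ1 * σ2) * (σ2 * σ1) = _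
  have h := σ1_σ2_braid
  rw [x12, x13, ← mul_assoc (σ1 ^ 2), eq_mul_inv_iff_mul_eq]
  calc σ1 * σ2 * (σ2 * σ1) * σ2 = σ1 * σ2 * (σ2 * σ1 * σ2) := by group
    _ = σ1 * σ2 * (σ1 * σ2 * σ1) := by rw [h]
    _ = σ1 * (σ2 * σ1 * σ2) * σ1 := by group
    _ = σ1 * (σ1 * σ2 * σ1) * σ1 := by rw [h]
    _ = σ1 ^ 2 * (σ2 * σ1 ^ 2) := by rw [pow_two]; group

namespace NFI.HasPair

variable {N : NFI} {T : PaB ⟶ N.quot} {m : ℤ} {f : Braid 3}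

/-- The first strand of the braiding is doubled, so that a block of two letters passes the third;
the next lemma doubles the second strand. -/
theorem σ1σ2_sends (hT : HasPair T m f) :
    Sends T (n := 3) (by omega) (⋆ * ⋆ * ⋆) (⋆ * (⋆ * ⋆)) (σ1 * σ2)
      (σ1 * σ2 * (x13 * x23) ^ m) := by
  have one₂ : Sends T (n := 1 + 1) (by omega) (⋆ * ⋆) (⋆ * ⋆) 1 1 := .one rfl
  have h := hT.braiding.ins one₂ (by omega) 0 rfl rfl
  have hy : ρ (y12 ^ m) = 1 := GTShadow.mem_PB.1 (zpow_mem y12'.2 m)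
  simp only [insBraid_one_right, dbl_mul, dbl_y12_zpow, hy, Equiv.Perm.one_apply, dbl_zero_y12,
    dbl_σ, ρ_σ] at h
  exact h

theorem σ2σ1_sends (hT : HasPair T m f) :
    Sends T (n := 3) (by omega) (⋆ * (⋆ * ⋆)) (⋆ * ⋆ * ⋆) (σ2 * σ1)
      (σ2 * σ1 * (x12 * x13) ^ m) := by
  have one₂ : Sends T (n := 1 + 1) (by omega) (⋆ * ⋆) (⋆ * ⋆) 1 1 := .one rfl
  have h := hT.braiding.ins one₂ (by omega) 1 rfl rfl
  have hy : ρ (y12 ^ m) = 1 := GTShadow.mem_PB.1 (zpow_mem y12'.2 m)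
  simp only [insBraid_one_right, dbl_mul, dbl_y12_zpow, hy, Equiv.Perm.one_apply, dbl_one_y12,
    dbl_σ, ρ_σ] at h
  exact h

/-- Each relation evaluates T on one morphism factored in two ways: σ₁σ₂ and σ₂σ₁ with the
associator for the hexagons, and the two paths around the pentagon. The representing braids then
agree modulo N. -/
theorem isGTPair {f : PB 3} (hT : HasPair T m f.1) : N.IsGTPair m f where
  hexagon₁ := by
    have h₁ := hT.σ1_sends.comp hT.σ2_sends
    have h₂ := hT.assoc.inv.comp hT.σ1σ2_sends
    rw [inv_one, one_mul] at h₂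
    rw [QuotientGroup.eq]
    convert! h₁.unique h₂ using 1
    group
  hexagon₂ := by
    have h₁ := hT.σ2_sends.comp hT.σ1_sends
    have h₂ := hT.σ2σ1_sends.comp hT.assoc
    rw [mul_one] at h₂
    rw [QuotientGroup.eq]
    convert! h₁.unique h₂ using 1
    group
  pentagon := by
    have one₂ : Sends T (n := 2) (by omega) (⋆ * ⋆) (⋆ * ⋆) 1 1 := .one rfl
    have one₂' : Sends T (n := 1 + 1) (by omega) (⋆ * ⋆) (⋆ * ⋆) 1 1 := .one rfl
    have c₀ := one₂.ins_one (k := 2) hT.assoc (by omega) 0 rfl rfl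
    have c₁ := one₂.ins_one (k := 2) hT.assoc (by omega) 1 rfl rfl
    have d₀ := hT.assoc.ins_one one₂' (by omega) 0 rfl rfl
    have d₁ := hT.assoc.ins_one one₂' (by omega) 1 rfl rfl
    have d₂ := hT.assoc.ins_one one₂' (by omega) 2 rfl rfl
    simp only [insBraid_one_right, dbl_one] at d₀ d₁ d₂
    simp only [insBraid_one_left, map_one] at c₀ c₁
    have h₁ := (c₁.comp d₁).comp c₀
    have h₂ := d₂.comp d₀
    simp only [mul_one] at h₁ h₂
    rw [QuotientGroup.eq]
    exact h₁.unique h₂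

/-- A value of T has the permutation of its argument. The value on α is therefore pure, and the
value on β is σ₁ times a pure braid of B₂, that is, a power of y₁₂. -/
theorem exists_hasPair (T : PaB ⟶ N.quot) : ∃ (m : ℤ) (f : PB 3), HasPair T m f.1 := by
  obtain ⟨f, hf⟩ := Sends.total T (n := 3) (by omega) (t := ⋆ * ⋆ * ⋆) (t' := ⋆ * (⋆ * ⋆))
    rfl rfl 1
  obtain ⟨g, hg⟩ := Sends.total T (n := 2) (by omega) (t := ⋆ * ⋆) (t' := ⋆ * ⋆)
    rfl rfl (σ 0 (by omega))
  obtain ⟨m, hm⟩ := PB_two_eq_zpow (g := (σ 0 (by omega))⁻¹ * g) (by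
    rw [GTShadow.mem_PB, map_mul, map_inv, hg.perm_eq, inv_mul_cancel])
  rw [inv_mul_eq_iff_eq_mul] at hm
  subst hm
  exact ⟨m, ⟨f, GTShadow.mem_PB.2 (hf.perm_eq.trans (map_one ρ))⟩, hf, hg⟩

theorem pair_eq {m' : ℤ} {f f' : PB 3} (hT : HasPair T m f.1) (hT' : HasPair T m' f'.1) :
    N.pair m f = N.pair m' f' := by
  rw [N.pair_eq_iff]
  refine ⟨?_, hT.assoc.unique hT'.assoc⟩
  convert! hT.braiding.unique hT'.braiding using 1
  rw [zpow_sub, (Commute.refl y12).zpow_zpow _ _ |>.inv_right.eq]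
  group

theorem congr {m' : ℤ} {f f' : PB 3} (hT : HasPair T m f.1) (h : N.pair m f = N.pair m' f') :
    HasPair T m' f'.1 := by
  rw [N.pair_eq_iff] at h
  refine ⟨hT.assoc.congr h.2, hT.braiding.congr ?_⟩
  convert! h.1 using 1
  rw [zpow_sub, (Commute.refl y12).zpow_zpow _ _ |>.inv_right.eq]
  group

theorem agree {T' : PaB ⟶ N.quot} (hT : HasPair T m f) (hT' : HasPair T' m f) : T = T' := by
  refine TruncOperad.Map.ext ?_
  funext n hn a b γ
  obtain ⟨g, h, h'⟩ := NFI.agree_of_αβ (T := T) (T' := T') ⟨_, hT.assoc, hT'.assoc⟩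
    ⟨_, hT.braiding, hT'.braiding⟩ hn a.length_tree b.length_tree γ.braid
  obtain ⟨γ₁, h₁, e₁⟩ := h.mor rfl rfl γ rfl
  obtain ⟨γ₂, h₂, e₂⟩ := h'.mor rfl rfl γ rfl
  rw [e₁, e₂, Mor.ext (h₁.trans h₂.symm)]

theorem iff_map {f : PB 3} : HasPair T m f.1 ↔
    T.map (by omega) α = Quotient.mk _ (α.comp (𝔪 f)) ∧
    T.map (by omega) β = Quotient.mk _ (β.comp (𝔪 (y12' ^ m))) := by
  have e₁ : (α.comp (𝔪 f)).braid = f.1 := one_mul _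
  have e₂ : (β.comp (𝔪 (y12' ^ m))).braid = σ 0 (by omega) * y12 ^ m :=
    congrArg (_ * ·) (y12'_val m)
  constructor
  · rintro ⟨h₁, h₂⟩
    rw [← e₁] at h₁
    rw [← e₂] at h₂
    exact ⟨h₁.map_eq (a := std 2) (b := obj1_23), h₂.map_eq (a := std 1) (b := obj21)⟩
  · rintro ⟨h₁, h₂⟩
    have h₁ := Sends.of_map h₁
    have h₂ := Sends.of_map h₂
    rw [e₁] at h₁
    rw [e₂] at h₂
    exact ⟨h₁, h₂⟩

end NFI.HasPair

/-- The hexagon and pentagon relations can be dropped, since any actual morphism satisfies them. -/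
theorem NFI.isMorOf_iff {N : NFI} {T : PaB ⟶ N.quot} {p : N.Pair} :
    N.IsMorOf T p ↔ ∃ (m : ℤ) (f : PB 3), p = N.pair m f ∧ HasPair T m f.1 :=
  ⟨fun ⟨m, f, hp, _, hα, hβ⟩ => ⟨m, f, hp, HasPair.iff_map.2 ⟨hα, hβ⟩⟩,
    fun ⟨m, f, hp, hT⟩ => ⟨m, f, hp, hT.isGTPair, HasPair.iff_map.1 hT⟩⟩

theorem NFI.isMorOf_pair_iff {N : NFI} {T : PaB ⟶ N.quot} {m : ℤ} {f : PB 3} :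
    N.IsMorOf T (N.pair m f) ↔ HasPair T m f.1 :=
  ⟨fun h => by
    obtain ⟨m', f', hp, hT⟩ := isMorOf_iff.1 h
    exact hT.congr hp.symm, fun h => isMorOf_iff.2 ⟨m, f, rfl, h⟩⟩

theorem NFI.IsMorOf.pair_eq {N : NFI} {T : PaB ⟶ N.quot} {p p' : N.Pair} (h : N.IsMorOf T p)
    (h' : N.IsMorOf T p') : p = p' := by
  obtain ⟨m, f, rfl, hT⟩ := isMorOf_iff.1 h
  obtain ⟨m', f', rfl, hT'⟩ := isMorOf_iff.1 h'
  exact hT.pair_eq hT'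

theorem NFI.IsMorOf.mor_eq {N : NFI} {T T' : PaB ⟶ N.quot} {p : N.Pair} (h : N.IsMorOf T p)
    (h' : N.IsMorOf T' p) : T = T' := by
  obtain ⟨m, f, rfl, hT⟩ := isMorOf_iff.1 h
  exact hT.agree (isMorOf_pair_iff.1 h')

theorem NFI.exists_isMorOf {N : NFI} (T : PaB ⟶ N.quot) : ∃ p, N.IsMorOf T p := by
  obtain ⟨m, f, hT⟩ := HasPair.exists_hasPair T
  exact ⟨_, isMorOf_pair_iff.2 hT⟩

/-! ### Kernels and images -/

namespace NFI.Sends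

variable {N : NFI} {T : PaB ⟶ N.quot} {n : ℕ} {hn : n ≤ 4} {t t' : FreeMagma Unit}
  {g g' h h' : Braid n}

/-- Conjugate by a change of parenthesization; the identity is fixed by conjugation. -/
theorem change_tree (ht' : t'.length = n) (hs : Sends T hn t t h 1) : Sends T hn t' t' h 1 := by
  obtain ⟨c, hc⟩ := total T hn hs.length_left ht' 1
  simpa using (hc.comp hs).comp hc.inv

theorem embed_left {M : ℕ} {hM : M ≤ 4} {hn' : n ≤ 4} (hs : Sends T hn' t t' h h')
    (e : n + 1 = M) :
    Sends T hM (t * ⋆) (t' * ⋆) (embed 0 (by omega) h) (embed 0 (by omega) h') := by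
  obtain ⟨k, rfl⟩ : ∃ k, n = k + 1 := ⟨n - 1, by
    have := tree_length_pos t
    have := hs.length_left
    omega⟩
  obtain rfl : 2 + k = M := by omega
  have one₂ : Sends T (n := 2) (by omega) (⋆ * ⋆) (⋆ * ⋆) 1 1 := .one rfl
  have := one₂.ins_one hs hM 0 rfl rfl
  rwa [insBraid_one_left, insBraid_one_left] at this

theorem embed_right {M : ℕ} {hM : M ≤ 4} {hn' : n ≤ 4} (hs : Sends T hn' t t' h h')
    (e : n + 1 = M) :
    Sends T hM (⋆ * t) (⋆ * t') (embed 1 (by omega) h) (embed 1 (by omega) h') := by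
  obtain ⟨k, rfl⟩ : ∃ k, n = k + 1 := ⟨n - 1, by
    have := tree_length_pos t
    have := hs.length_left
    omega⟩
  obtain rfl : 2 + k = M := by omega
  have one₂ : Sends T (n := 2) (by omega) (⋆ * ⋆) (⋆ * ⋆) 1 1 := .one rfl
  have := one₂.ins_one hs hM 1 rfl rfl
  rwa [insBraid_one_left, insBraid_one_left] at this

theorem dbl (hs : Sends T hn t t' h h') (hM : n + 1 ≤ 4) (p : Fin n) :
    Sends T hM (graft t p (⋆ * ⋆)) (graft t' (ρ h p) (⋆ * ⋆)) (dbl p h) (GTShadow.dbl p h') := by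
  have one₂ : Sends T (n := 1 + 1) (by omega) (⋆ * ⋆) (⋆ * ⋆) 1 1 := .one rfl
  have := hs.ins one₂ hM p rfl rfl
  rwa [insBraid_one_right, insBraid_one_right] at this

/-- The kernel of `T` in arity `n` is obtained from the one in arity `n + 1`. -/
theorem iff_mem_face (hM : n + 1 ≤ 4) (hN : N.sub n = face (N.sub (n + 1)))
    {K : Subgroup (Braid (n + 1))}
    (hK : ∀ (t : FreeMagma Unit) (h : Braid (n + 1)), t.length = n + 1 →
      (Sends T hM t t h 1 ↔ h ∈ K))
    (ht : t.length = n) : Sends T hn t t h 1 ↔ h ∈ face K := by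
  constructor
  · intro hs
    have hρ : ρ h = 1 := by rw [← hs.perm_eq, map_one]
    have h₀ := hs.embed_left (hM := hM) rfl
    have h₁ := hs.embed_right (hM := hM) rfl
    rw [map_one, hK _ _ h₀.length_left] at h₀
    rw [map_one, hK _ _ h₁.length_left] at h₁
    refine ⟨mem_PB.2 hρ, h₀, h₁, fun p => ?_⟩
    have h₂ := hs.dbl hM p
    rw [hρ, Equiv.Perm.one_apply, dbl_one] at h₂
    rwa [hK _ _ h₂.length_left] at h₂
  · rintro ⟨hρ, h₀, h₁, h₂⟩
    rw [mem_PB] at hρ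
    -- The cofaces of the image `x` are the images of the cofaces of `h`. Those lie in `K` and so
    -- become trivial, which puts `x` in the face of `N.sub (n + 1)`, that is, in `N.sub n`.
    obtain ⟨x, hx⟩ := total T hn ht ht h
    have hxρ := hx.perm_eq.trans hρ
    refine hx.congr ?_
    rw [mul_one, inv_mem_iff, hN]
    have key : ∀ {t : FreeMagma Unit} {g g' : Braid (n + 1)}, Sends T hM t t g g' → g ∈ K →
        g' ∈ N.sub (n + 1) := fun hs hg => by
      simpa using hs.unique ((hK _ _ hs.length_left).2 hg)
    refine ⟨mem_PB.2 hxρ, key (hx.embed_left rfl) h₀, key (hx.embed_right rfl) h₁, fun p => ?_⟩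
    have h₃ := hx.dbl hM p
    rw [hρ, Equiv.Perm.one_apply] at h₃
    exact key h₃ (h₂ p)

end NFI.Sends

namespace NFI

variable {N N' : NFI} {T : PaB ⟶ N.quot}

theorem onPB_eq_iff {k : ℕ} (hk : k + 1 ≤ 4) {g h : PB (k + 1)} :
    N.onPB T hk g = QuotientGroup.mk h.1 ↔ Sends T hk (leftTree k) (leftTree k) g.1 h.1 := by
  obtain ⟨γ, e⟩ := Quotient.exists_rep (T.map hk (𝔪 g))
  have hγ : Sends T hk (leftTree k) (leftTree k) g.1 γ.braid := Sends.of_map e.symm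
  rw [onPB, ← e]
  change QuotientGroup.mk γ.braid = _ ↔ _
  rw [QuotientGroup.eq]
  exact ⟨hγ.congr, hγ.unique⟩

/-- The kernel of `T` in arity four is `N'`. -/
def HasKernel (N' : NFI) {N : NFI} (T : PaB ⟶ N.quot) : Prop :=
  ∀ g : Braid 4, g ∈ N'.grp ↔
    ∃ hg : g ∈ PB 4, N.onPB T (k := 3) (by omega) ⟨g, hg⟩ = QuotientGroup.mk 1

/-- Arity four is the hypothesis, transported to an arbitrary parenthesization; arities three and
two follow by taking faces, exactly as `N'.sub` is built. -/
theorem HasKernel.sends_iff (hT : HasKernel N' T) {n : ℕ} (hn : n ≤ 4) {t : FreeMagma Unit}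
    (ht : t.length = n) {g : Braid n} : Sends T hn t t g 1 ↔ g ∈ N'.sub n := by
  have h₄ : ∀ (t : FreeMagma Unit) (g : Braid 4), t.length = 4 →
      (Sends T (by omega) t t g 1 ↔ g ∈ N'.sub 4) := by
    intro t g ht
    refine Iff.trans ?_ (hT g).symm
    constructor
    · intro hs
      have hg : g ∈ PB 4 := mem_PB.2 (by rw [← hs.perm_eq, map_one])
      refine ⟨hg, ?_⟩
      exact (onPB_eq_iff (k := 3) (g := ⟨g, hg⟩) (h := 1) _).2 (hs.change_tree rfl)
    · rintro ⟨hg, e⟩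
      exact ((onPB_eq_iff (k := 3) (g := ⟨g, hg⟩) (h := 1) _).1 e).change_tree ht
  have h₃ : ∀ (t : FreeMagma Unit) (g : Braid 3), t.length = 3 →
      (Sends T (by omega) t t g 1 ↔ g ∈ N'.sub 3) :=
    fun t g ht => Sends.iff_mem_face (n := 3) le_rfl rfl h₄ ht
  have h₂ : ∀ (t : FreeMagma Unit) (g : Braid 2), t.length = 2 →
      (Sends T (by omega) t t g 1 ↔ g ∈ N'.sub 2) :=
    fun t g ht => Sends.iff_mem_face (n := 2) (by omega) rfl h₃ ht
  obtain rfl | rfl | rfl | rfl | rfl : n = 0 ∨ n = 1 ∨ n = 2 ∨ n = 3 ∨ n = 4 := by omega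
  · exact absurd ht (tree_length_pos t).ne'
  · rw [braid_eq_one_of_le_one le_rfl g]
    exact iff_of_true (.one ht) (one_mem _)
  · exact h₂ t g ht
  · exact h₃ t g ht
  · exact h₄ t g ht

theorem HasKernel.map_eq_iff (hT : HasKernel N' T) {n : ℕ} (hn : n ≤ 4) {a b : Obj n}
    (γ γ' : Mor a b) : T.map hn γ = T.map hn γ' ↔ (N'.rel a b).r γ γ' := by
  obtain ⟨δ, e⟩ := Quotient.exists_rep (T.map hn γ)
  have hs : Sends T hn a.tree b.tree γ.braid δ.braid := Sends.of_map e.symm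
  change _ ↔ γ.braid⁻¹ * γ'.braid ∈ N'.sub n
  rw [← hT.sends_iff hn a.length_tree, ← e]
  constructor
  · intro h
    have hs' : Sends T hn a.tree b.tree γ'.braid δ.braid := Sends.of_map h.symm
    simpa using hs.inv.comp hs'
  · intro h
    have hs' := hs.comp h
    rw [mul_inv_cancel_left, mul_one] at hs'
    exact hs'.map_eq.symm

/-- `T` is surjective on morphisms. -/
def Full (T : PaB ⟶ N.quot) : Prop :=
  ∀ {n : ℕ} (hn : n ≤ 4) (t t' : FreeMagma Unit) (g' : Braid n), t.length = n → t'.length = n →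
    ∃ g, Sends T hn t t' g g'

/-- Surjectivity on pure automorphisms of the standard object suffices: every morphism is such an
automorphism composed with fixed morphisms on both sides. -/
theorem full_of_onto (h₂ : N.Onto T (k := 1) (by omega)) (h₃ : N.Onto T (k := 2) (by omega))
    (h₄ : N.Onto T (k := 3) (by omega)) : Full T := by
  intro n hn t t' g' ht ht'
  have key : ∀ {k : ℕ} (hk : k + 1 ≤ 4), N.Onto T hk → ∀ (t t' : FreeMagma Unit)
      (g' : Braid (k + 1)), t.length = k + 1 → t'.length = k + 1 →
      ∃ g, Sends T hk t t' g g' := by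
    intro k hk ho t t' g' ht ht'
    -- `x` is the image of `g'` itself from the standard word to `t'`, and `y` that of the identity
    -- braid from `t` to the standard word. The remaining factor `x⁻¹ * g' * y⁻¹` is pure, so
    -- surjectivity applies to it.
    obtain ⟨x, hx⟩ := Sends.total T hk (length_leftTree k) ht' g'
    obtain ⟨y, hy⟩ := Sends.total T hk ht (length_leftTree k) 1
    obtain ⟨g, hg⟩ := ho ⟨x⁻¹ * g' * y⁻¹, by
      rw [mem_PB, map_mul, map_mul, map_inv, map_inv, hx.perm_eq, hy.perm_eq]; simp⟩
    rw [onPB_eq_iff] at hg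
    have := (hx.comp hg).comp hy
    exact ⟨_, by simpa [mul_assoc] using this⟩
  obtain rfl | rfl | rfl | rfl | rfl : n = 0 ∨ n = 1 ∨ n = 2 ∨ n = 3 ∨ n = 4 := by omega
  · exact absurd ht (tree_length_pos t).ne'
  · rw [tree_one ht, tree_one ht', braid_eq_one_of_le_one le_rfl g']
    exact ⟨1, .one rfl⟩
  · exact key _ h₂ t t' g' ht ht'
  · exact key _ h₃ t t' g' ht ht'
  · exact key _ h₄ t t' g' ht ht'

theorem Full.exists_map_eq (hT : Full T) {n : ℕ} (hn : n ≤ 4) {a b : Obj n}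
    (x : N.quot.Hom a b) : ∃ γ : Mor a b, T.map hn γ = x := by
  obtain ⟨γ', rfl⟩ := Quotient.exists_rep x
  obtain ⟨g, hg⟩ := hT hn a.tree b.tree γ'.braid a.length_tree b.length_tree
  have hρ : ρ g = ρ γ'.braid := hg.perm_eq.symm
  exact ⟨⟨g, hρ ▸ γ'.lab_eq⟩, hg.map_eq (γ := ⟨g, hρ ▸ γ'.lab_eq⟩)⟩

end NFI

/-! ### Isomorphisms of the quotients -/

/-- A morphism of truncated operads that is bijective on morphisms is an isomorphism. -/
theorem TruncOperad.isIso_of_bijective {A B : TruncOperad} (F : A ⟶ B)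
    (hF : ∀ {n : ℕ} (hn : n ≤ 4) (a b : Obj n),
      Function.Bijective (fun γ : A.Hom a b => F.map hn γ)) : IsIso F := by
  let G {n : ℕ} (hn : n ≤ 4) {a b : Obj n} (x : B.Hom a b) : A.Hom a b :=
    ((hF hn a b).2 x).choose
  have FG : ∀ {n : ℕ} (hn : n ≤ 4) {a b : Obj n} (x : B.Hom a b), F.map hn (G hn x) = x :=
    fun hn a b x => ((hF hn a b).2 x).choose_spec
  have inj : ∀ {n : ℕ} (hn : n ≤ 4) {a b : Obj n} {x y : A.Hom a b},
      F.map hn x = F.map hn y → x = y := fun hn a b x y h => (hF hn a b).1 h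
  -- Each law for the inverse holds after applying `F`, which is injective on morphisms.
  let G' : TruncOperad.Map B A :=
    { map := G
      map_id := fun hn a => inj hn (by rw [FG]; exact (F.map_id hn a).symm)
      map_comp := fun hn a b c γ η => inj hn (by
        rw [FG]
        refine Eq.trans ?_ (F.map_comp hn _ _).symm
        rw [FG, FG])
      map_act := fun hn a b θ γ => inj hn (by
        rw [FG]
        refine Eq.trans ?_ (F.map_act hn _ _).symm
        rw [FG])
      map_ins := fun hn hk h a b c d γ i η => inj h (by
        rw [FG]
        refine Eq.trans ?_ (F.map_ins hn hk h _ _ _).symm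
        rw [FG, FG]) }
  refine ⟨G', TruncOperad.Map.ext ?_, TruncOperad.Map.ext ?_⟩
  · funext n hn a b γ
    exact inj hn (FG hn _)
  · funext n hn a b γ
    exact FG hn γ

/-- The morphism induced on the quotient by `N'`. -/
def NFI.HasKernel.desc {N N' : NFI} {T : PaB ⟶ N.quot} (hT : HasKernel N' T) : N'.quot ⟶ N.quot :=
  { map := fun hn a b => Quotient.lift (T.map hn) fun γ γ' h => (hT.map_eq_iff hn γ γ').2 h
    map_id := fun hn a => T.map_id hn a
    map_comp := fun hn a b c γ η => by
      induction γ using Quotient.inductionOn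
      induction η using Quotient.inductionOn
      exact T.map_comp hn _ _
    map_act := fun hn a b θ γ => by
      induction γ using Quotient.inductionOn
      exact T.map_act hn _ _
    map_ins := fun hn hk h a b c d γ i η => by
      induction γ using Quotient.inductionOn
      induction η using Quotient.inductionOn
      exact T.map_ins hn hk h _ _ _ : TruncOperad.Map _ _ }

theorem NFI.HasKernel.isIso_desc {N N' : NFI} {T : PaB ⟶ N.quot} (hT : HasKernel N' T)
    (hT' : Full T) : IsIso hT.desc := by
  refine TruncOperad.isIso_of_bijective _ fun hn a b => ⟨fun x y h => ?_, fun x => ?_⟩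
  · induction x using Quotient.inductionOn
    induction y using Quotient.inductionOn
    exact Quotient.sound ((hT.map_eq_iff hn _ _).1 h)
  · obtain ⟨γ, rfl⟩ := hT'.exists_map_eq hn x
    exact ⟨Quotient.mk _ γ, rfl⟩

/-- The projection is surjective on morphisms, hence epi. -/
theorem NFI.proj_cancel {N N' : NFI} {F G : N'.quot ⟶ N.quot}
    (h : N'.proj ≫ F = N'.proj ≫ G) : F = G := by
  refine TruncOperad.Map.ext ?_
  funext n hn a b γ
  induction γ using Quotient.inductionOn with
  | h γ =>
    have := congrArg (fun H : PaB.Map N.quot => H.map hn γ) h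
    exact this

/-! ### Charming morphisms -/

/-- A relation compatible with the group structures that relates each element of `H` to an element
of `K` does the same for the commutator subgroups. -/
theorem commutator_relate {G G' : Type*} [Group G] [Group G'] {R : G → G' → Prop} (one : R 1 1)
    (mul : ∀ {a b a' b'}, R a a' → R b b' → R (a * b) (a' * b'))
    (inv : ∀ {a a'}, R a a' → R a⁻¹ a'⁻¹) {H : Subgroup G} {K : Subgroup G'}
    (hR : ∀ g ∈ H, ∃ g' ∈ K, R g g') : ∀ g ∈ ⁅H, H⁆, ∃ g' ∈ ⁅K, K⁆, R g g' := by
  intro g hg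
  rw [Subgroup.commutator_def] at hg
  induction hg using Subgroup.closure_induction with
  | mem x hx =>
    obtain ⟨a, ha, b, hb, rfl⟩ := hx
    obtain ⟨a', ha', h₁⟩ := hR a ha
    obtain ⟨b', hb', h₂⟩ := hR b hb
    exact ⟨_, Subgroup.commutator_mem_commutator ha' hb',
      mul (mul (mul h₁ h₂) (inv h₁)) (inv h₂)⟩
  | one => exact ⟨1, one_mem _, one⟩
  | mul x y _ _ hx hy =>
    obtain ⟨x', hx', h₁⟩ := hx
    obtain ⟨y', hy', h₂⟩ := hy
    exact ⟨_, mul_mem hx' hy', mul h₁ h₂⟩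
  | inv x _ hx =>
    obtain ⟨x', hx', h₁⟩ := hx
    exact ⟨_, inv_mem hx', inv h₁⟩

theorem F₂_le_PB : F₂ ≤ PB 3 := by
  refine (Subgroup.closure_le (PB 3)).2 ?_
  rintro x (rfl | rfl)
  · rw [SetLike.mem_coe, mem_PB, x12, σ1, map_pow, ρ_σ, pow_two]
    exact Equiv.swap_mul_self _ _
  · rw [SetLike.mem_coe, mem_PB, x23, σ2, map_pow, ρ_σ, pow_two]
    exact Equiv.swap_mul_self _ _

theorem commutator_F₂_le : ⁅F₂, F₂⁆ ≤ F₂ :=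
  Subgroup.commutator_le.2 fun _ ha _ hb =>
    mul_mem (mul_mem (mul_mem ha hb) (inv_mem ha)) (inv_mem hb)

namespace NFI

variable {N N' N'' : NFI} {T : PaB ⟶ N.quot} {m : ℤ} {f : Braid 3}

/-- It suffices to treat the generators: x₁₂ = σ₁² goes to the power 2m + 1 of x₁₂, and x₂₃ to the
f-conjugate of the power 2m + 1 of x₂₃. -/
theorem HasPair.sends_F₂ (hT : HasPair T m f) (hf : f ∈ F₂) :
    ∀ g ∈ F₂, ∃ g' ∈ F₂, Sends T (n := 3) (by omega) (⋆ * ⋆ * ⋆) (⋆ * ⋆ * ⋆) g g' := by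
  have h12 : x12 ∈ F₂ := Subgroup.subset_closure (Or.inl rfl)
  have h23 : x23 ∈ F₂ := Subgroup.subset_closure (Or.inr rfl)
  have pow_sq : ∀ (s : Braid 3), (s * (s ^ 2) ^ m) * (s * (s ^ 2) ^ m) =
      (s ^ 2) ^ (2 * m + 1) := fun s => by
    rw [← zpow_natCast, ← zpow_mul, ← zpow_mul, ← zpow_one_add, ← zpow_add]
    congr 1
    push_cast
    ring
  intro g hg
  induction hg using Subgroup.closure_induction with
  | mem x hx =>
    obtain rfl | rfl := hx
    · refine ⟨x12 ^ (2 * m + 1), zpow_mem h12 _, ?_⟩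
      have := hT.σ1_sends.comp hT.σ1_sends
      rwa [← pow_two, x12, pow_sq] at this
    · refine ⟨f⁻¹ * x23 ^ (2 * m + 1) * f, mul_mem (mul_mem (inv_mem hf) (zpow_mem h23 _)) hf, ?_⟩
      have := (hT.assoc.inv.comp (hT.σ2_sends_right.comp hT.σ2_sends_right)).comp hT.assoc
      rw [← pow_two, x23, pow_sq] at this
      simpa [x23] using this
  | one => exact ⟨1, one_mem _, .one rfl⟩
  | mul x y _ _ hx hy =>
    obtain ⟨x', hx', h₁⟩ := hx
    obtain ⟨y', hy', h₂⟩ := hy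
    exact ⟨_, mul_mem hx' hy', h₁.comp h₂⟩
  | inv x _ hx =>
    obtain ⟨x', hx', h₁⟩ := hx
    exact ⟨_, inv_mem hx', h₁.inv⟩

/-- `T` is given by a pair `(m, f)` with `f` in the commutator subgroup of `F₂`, and its
restriction to `F₂` is onto. -/
def Charming (T : PaB ⟶ N.quot) : Prop :=
  (∃ (m : ℤ) (f : Braid 3), HasPair T m f ∧ f ∈ ⁅F₂, F₂⁆) ∧
    ∀ h ∈ F₂, ∃ g ∈ F₂, Sends T (n := 3) (by omega) (⋆ * ⋆ * ⋆) (⋆ * ⋆ * ⋆) g h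

/-! ### Composites and inverses -/

section

variable {n : ℕ} {hn : n ≤ 4} {t t' : FreeMagma Unit} {g g' g'' : Braid n}

theorem Sends.trans {F : N''.quot ⟶ N'.quot} {G : N'.quot ⟶ N.quot}
    (h₁ : Sends (N''.proj ≫ F) hn t t' g g') (h₂ : Sends (N'.proj ≫ G) hn t t' g' g'') :
    Sends (N''.proj ≫ F ≫ G) hn t t' g g'' := by
  obtain ⟨a, b, γ, γ', ha, hb, hγ, hγ', e⟩ := h₁
  obtain ⟨γ'', hγ'', e'⟩ := h₂.mor ha hb γ' hγ'
  exact ⟨a, b, γ, γ'', ha, hb, hγ, hγ'', (congrArg (G.map hn) e).trans e'⟩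

/-- Since the relation is between braids rather than cosets, inverting an isomorphism simply swaps
its two arguments. -/
theorem Sends.of_iso (I : N'.quot ≅ N.quot) (h : Sends (N'.proj ≫ I.hom) hn t t' g g') :
    Sends (N.proj ≫ I.inv) hn t t' g' g := by
  obtain ⟨a, b, γ, γ', ha, hb, hγ, hγ', e⟩ := h
  refine ⟨a, b, γ', γ, ha, hb, hγ', hγ, (congrArg (I.inv.map hn) e).symm.trans ?_⟩
  exact congrArg (fun F : N'.quot.Map N'.quot => F.map hn (Quotient.mk _ γ)) I.hom_inv_id

theorem sends_id (ht : t.length = n) (ht' : t'.length = n) (g : Braid n) :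
    Sends N.proj hn t t' g g :=
  ⟨⟨t, ht, ρ g⟩, ⟨t', ht', 1⟩, ⟨g, one_mul _⟩, ⟨g, one_mul _⟩, rfl, rfl, rfl, rfl, rfl⟩

end

/-- Preimages are images under the inverse isomorphism. -/
theorem full_of_iso (I : N'.quot ≅ N.quot) : Full (N'.proj ≫ I.hom) := by
  intro n hn t t' g' ht ht'
  obtain ⟨g, hg⟩ := Sends.total (N.proj ≫ I.inv) hn ht ht' g'
  exact ⟨g, Sends.of_iso I.symm hg⟩

theorem Full.onto (hT : Full T) {k : ℕ} (hk : k + 1 ≤ 4) : N.Onto T hk := by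
  intro h
  obtain ⟨g, hg⟩ := hT hk (leftTree k) (leftTree k) h.1 (length_leftTree k) (length_leftTree k)
  have hρ : g ∈ PB (k + 1) := mem_PB.2 (hg.perm_eq.symm.trans (mem_PB.1 h.2))
  exact ⟨⟨g, hρ⟩, (onPB_eq_iff hk).2 hg⟩

theorem hasKernel_of_iso (I : N'.quot ≅ N.quot) : HasKernel N' (N'.proj ≫ I.hom) := by
  intro g
  constructor
  · intro hg
    have hg' : Sends N'.proj (n := 4) le_rfl (leftTree 3) (leftTree 3) g 1 :=
      (sends_id (n := 4) rfl rfl g).congr (by rw [mul_one]; exact inv_mem hg)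
    refine ⟨N'.le_PB hg, (onPB_eq_iff (k := 3) (g := ⟨g, N'.le_PB hg⟩) (h := 1) _).2 ?_⟩
    exact Sends.trans (F := 𝟙 N'.quot) hg' (.one rfl)
  · rintro ⟨hg, e⟩
    -- The inverse sends 1 both to 1 and to `g`, so `g` lies in N'.
    have h : Sends (N.proj ≫ I.inv) (n := 4) le_rfl (leftTree 3) (leftTree 3) 1 g := Sends.of_iso I ((onPB_eq_iff (k := 3) (g := ⟨g, hg⟩) (h := 1) _).1 e)
    have := (Sends.one (n := 4) rfl).unique h
    rwa [inv_one, one_mul] at this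

theorem charming_id : Charming N.proj := by
  obtain ⟨m, f, hT⟩ := HasPair.exists_hasPair N.proj
  exact ⟨⟨m, 1, ⟨sends_id (n := 3) rfl rfl 1, hT.braiding⟩, one_mem _⟩,
    fun h hh => ⟨h, hh, sends_id (n := 3) rfl rfl h⟩⟩

/-- The composite twists the associator by f₂ · T₂(f₁). As T₂ carries F₂ to F₂, it carries [F₂, F₂]
to [F₂, F₂]. -/
theorem Charming.comp {F : N''.quot ⟶ N'.quot} {G : N'.quot ⟶ N.quot}
    (hF : Charming (N''.proj ≫ F)) (hG : Charming (N'.proj ≫ G)) :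
    Charming (N''.proj ≫ F ≫ G) := by
  obtain ⟨⟨m₁, f₁, h₁, hf₁⟩, o₁⟩ := hF
  obtain ⟨⟨m₂, f₂, h₂, hf₂⟩, o₂⟩ := hG
  -- Charm does not constrain the exponent, so only the value on the braiding is taken from this
  -- pair.
  obtain ⟨m, f, hT⟩ := HasPair.exists_hasPair (N''.proj ≫ F ≫ G)
  refine ⟨?_, fun h hh => ?_⟩
  · obtain ⟨x, hx, hs⟩ := commutator_relate
      (R := Sends (N'.proj ≫ G) (n := 3) (by omega) (⋆ * ⋆ * ⋆) (⋆ * ⋆ * ⋆))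
      (.one rfl) Sends.comp Sends.inv
      (h₂.sends_F₂ (commutator_F₂_le hf₂)) f₁ hf₁
    have hs' := h₂.assoc.comp hs
    rw [one_mul] at hs'
    exact ⟨m, f₂ * x, ⟨h₁.assoc.trans hs', hT.braiding⟩, mul_mem hf₂ hx⟩
  · obtain ⟨g, hg, hs⟩ := o₂ h hh
    obtain ⟨g', hg', hs'⟩ := o₁ g hg
    exact ⟨g', hg', hs'.trans hs⟩

/-- The two halves of charm trade roles: surjectivity on F₂ provides the commutator for the inverse,
by lifting f⁻¹ to [F₂, F₂], and preservation of F₂ becomes surjectivity of the inverse on F₂. -/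
theorem Charming.inv {I : N'.quot ≅ N.quot} (hI : Charming (N'.proj ≫ I.hom)) :
    Charming (N.proj ≫ I.inv) := by
  obtain ⟨⟨m, f, h, hf⟩, o⟩ := hI
  obtain ⟨m', f', hT⟩ := HasPair.exists_hasPair (N.proj ≫ I.inv)
  refine ⟨?_, fun g hg => ?_⟩
  · obtain ⟨x, hx, hs⟩ := commutator_relate
      (R := fun g' g => Sends (N'.proj ≫ I.hom) (n := 3) (by omega) (⋆ * ⋆ * ⋆) (⋆ * ⋆ * ⋆) g g')
      (.one rfl) Sends.comp Sends.inv o f⁻¹ (inv_mem hf)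
    have hs' := h.assoc.comp hs
    rw [one_mul, mul_inv_cancel] at hs'
    exact ⟨m', x, ⟨hs'.of_iso, hT.braiding⟩, hx⟩
  · obtain ⟨g', hg', hs⟩ := h.sends_F₂ (commutator_F₂_le hf) g hg
    exact ⟨g', hg', hs.of_iso⟩

/-! ### Charming morphisms and charming GT-shadows -/

theorem charming_of_mem_GTCharm {p : N.Pair} (hp : p ∈ N.GTCharm) (hT : N.IsMorOf T p) :
    Charming T := by
  obtain ⟨-, ⟨f, hf, hpf⟩, T', hT', ho⟩ := hp
  -- The definition quantifies separately over morphisms with the given pair, but there is only one.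
  obtain rfl := hT.mor_eq hT'
  obtain ⟨m, f₀, rfl, hT₀⟩ := isMorOf_iff.1 hT
  have : N.pair m f₀ = N.pair m f := Prod.ext rfl hpf
  refine ⟨⟨m, f.1, hT₀.congr this, hf⟩, fun h hh => ?_⟩
  obtain ⟨g, hg, e⟩ := ho h hh
  exact ⟨g.1, hg, (onPB_eq_iff (k := 2) (h := ⟨h, F₂_le_PB hh⟩) _).1 e⟩

theorem Charming.mem_GTCharm {p : N.Pair} (hc : Charming T) (hT : N.IsMorOf T p) (hf : Full T) :
    p ∈ N.GTCharm := by
  obtain ⟨⟨m, f, h, hfc⟩, o⟩ := hc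
  obtain rfl : p = N.pair m ⟨f, h.mem_PB⟩ :=
    hT.pair_eq (isMorOf_pair_iff.2 h)
  refine ⟨⟨T, hT, hf.onto _, hf.onto _, hf.onto _⟩, ⟨⟨f, h.mem_PB⟩, hfc, rfl⟩, T, hT, ?_⟩
  intro h hh
  obtain ⟨g, hg, hs⟩ := o h hh
  exact ⟨⟨g, F₂_le_PB hg⟩, hg,
    (onPB_eq_iff (k := 2) (g := ⟨g, F₂_le_PB hg⟩) (h := ⟨h, F₂_le_PB hh⟩) _).2 hs⟩

end NFI

/-- For an isomorphism, surjectivity in each arity and the condition on the source hold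
automatically, so only charm remains. -/
theorem mem_charmHom_iff {N' N : NFI} (T : N' ⟶ N) {p : N.Pair} (hT : Represents T p) :
    p ∈ charmHom N' N ↔ NFI.Charming (N'.proj ≫ (toIso T).hom) :=
  ⟨fun hp => NFI.charming_of_mem_GTCharm hp.1 hT, fun hc =>
    ⟨hc.mem_GTCharm hT (NFI.full_of_iso _), _, hT, NFI.hasKernel_of_iso _⟩⟩

theorem exists_represents_charmHom_iff {N' N : NFI} (T : N' ⟶ N) :
    (∃ p ∈ charmHom N' N, Represents T p) ↔ NFI.Charming (N'.proj ≫ (toIso T).hom) := by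
  obtain ⟨p, hp⟩ := NFI.exists_isMorOf (N'.proj ≫ (toIso T).hom)
  exact ⟨fun ⟨q, hq, hT⟩ => (mem_charmHom_iff T hT).1 hq,
    fun hc => ⟨p, (mem_charmHom_iff T hp).2 hc, hp⟩⟩

/-- The morphism of the pair is full with kernel N', so it descends to an isomorphism. Uniqueness
holds because the pair determines the composite with the projection, which can be cancelled. -/
theorem existsUnique_represents {N' N : NFI} {p : N.Pair} (hp : p ∈ charmHom N' N) :
    ∃! T : N' ⟶ N, Represents T p := by
  obtain ⟨⟨⟨T, hT, h₂, h₃, h₄⟩, -⟩, T', hT', hk⟩ := hp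
  obtain rfl := hT.mor_eq hT'
  have hk : NFI.HasKernel N' T := hk
  have := hk.isIso_desc (NFI.full_of_onto h₂ h₃ h₄)
  refine ⟨asIso hk.desc, hT, fun S hS => ?_⟩
  exact Iso.ext (NFI.proj_cancel (hS.mor_eq hT))

/-- The subgroupoid of the charming morphisms. -/
def charmingSubgroupoid : Subgroupoid NFI where
  arrows N' _ := {T | NFI.Charming (N'.proj ≫ (toIso T).hom)}
  inv hT := NFI.Charming.inv hT
  mul hT _ hS := NFI.Charming.comp hT hS

end GTShadow

/-- The charming GT-shadows form a wide subgroupoid of the groupoid of GT-shadows: the morphisms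
from `N'` to `N` in it are exactly the morphisms of `GTSh` that correspond to charming GT-shadows
with target `N` and source `N'`, and this correspondence is a bijection. -/
theorem proposition2p18 :
    ∃ S : CategoryTheory.Subgroupoid GTShadow.NFI, S.IsWide ∧
      ∀ N' N : GTShadow.NFI,
        (∀ T : N' ⟶ N, T ∈ S.arrows N' N ↔
          ∃ p ∈ GTShadow.charmHom N' N, GTShadow.Represents T p) ∧
        (∀ p ∈ GTShadow.charmHom N' N, ∃! T : N' ⟶ N, GTShadow.Represents T p) ∧
        (∀ T ∈ S.arrows N' N, ∃! p, p ∈ GTShadow.charmHom N' N ∧ GTShadow.Represents T p) := by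
  refine ⟨GTShadow.charmingSubgroupoid, ⟨fun _ => GTShadow.NFI.charming_id⟩, fun N' N =>
    ⟨fun T => (GTShadow.exists_represents_charmHom_iff T).symm,
      fun p hp => GTShadow.existsUnique_represents hp, fun T hT => ?_⟩⟩
  obtain ⟨p, hp, hR⟩ := (GTShadow.exists_represents_charmHom_iff T).2 hT
  exact ⟨p, ⟨hp, hR⟩, fun q hq => GTShadow.NFI.IsMorOf.pair_eq hq.2 hR⟩
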